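/- Let $M$ be a smooth manifold of dimension $2n+1$. For a one-form $\eta$ put $d\eta(X,Y)=X(\eta(Y))-Y(\eta(X))-\eta([X,Y])$. A contact metric structure $(\eta,\xi,\phi,g)$ on $M$ consists of a contact form $\eta$ (i.e. $\eta\wedge(d\eta)^n$ vanishes nowhere), a smooth vector field $\xi$, a smooth field $\phi$ of endomorphisms of $TM$ and a Riemannian metric $g$ such that $$g(\xi,\xi)=1,\quad \eta(\xi)=1,\quad \phi^2=-\mathrm{Id}+\eta\otimes\xi,\quad \phi\xi=0,\quad d\eta(X,Y)=2g(X,\phi Y).$$ For a field $A$ of endomorphisms let $(L_\xi A)X=[\xi,AX]-A[\xi,X]$, and put $h=\tfrac12 L_\xi\phi$. The structure is called K-contact if $h\equiv 0$. For real constants $\kappa,\mu$ it is called a weakly $(\kappa,\mu)$-space if $$R(X,\xi)\xi=\kappa\,(X-\eta(X)\xi)+\mu\,hX\quad\text{for all } X,$$ where $R(X,Y)Z=\nabla_X\nabla_YZ-\nabla_Y\nabla_XZ-\nabla_{[X,Y]}Z$ and $\nabla$ is the Levi-Civita connection of $g$. The Boeckx invariant of a non-K-contact weakly $(\kappa,\mu)$-space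 is $I_M=(1-\mu/2)/\sqrt{1-\kappa}$. Theorem (K-contact structures when $|I_M|>1$). Let $(M,\eta,\xi,\phi,g)$ be a non-K-contact weakly $(\kappa,\mu)$-space with $|I_M|>1$. Then $\kappa<1$, $(2-\mu)^2-4(1-\kappa)>0$, and $M$ carries a K-contact structure $(\eta,\xi,\bar\phi,\bar g)$ with the same contact form $\eta$ and the same vector field $\xi$, given by $$\bar\phi=\frac{\epsilon}{(1-\kappa)\sqrt{(2-\mu)^2-4(1-\kappa)}}\,(L_\xi h)\circ h,\qquad \bar g(X,Y)=-\tfrac12\,d\eta(X,\bar\phi Y)+\eta(X)\eta(Y),$$ where $\epsilon=+1$ if $I_M>0$ and $\epsilon=-1$ if $I_M<0$. -/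

import Mathlib

open Bundle
open scoped Manifold ContDiff

set_option linter.unusedSectionVars false

namespace ContactGeometry

noncomputable section

variable {E : Type*} [NormedAddCommGroup E] [NormedSpace ℝ E]
  {H : Type*} [TopologicalSpace H] {I : ModelWithCorners ℝ E H}
  {M : Type*} [TopologicalSpace M] [ChartedSpace H M]

/-- Vector fields (no regularity is built in). -/
abbrev VField (I : ModelWithCorners ℝ E H) (M : Type*) [TopologicalSpace M] [ChartedSpace H M] :=
  Π x : M, TangentSpace I x

/-- One-forms (no regularity is built in). -/
abbrev OneForm (I : ModelWithCorners ℝ E H) (M : Type*) [TopologicalSpace M] [ChartedSpace H M] :=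
  Π x : M, TangentSpace I x →L[ℝ] ℝ

/-- Fields of endomorphisms of the tangent bundle (no regularity is built in). -/
abbrev EndField (I : ModelWithCorners ℝ E H) (M : Type*) [TopologicalSpace M] [ChartedSpace H M] :=
  Π x : M, TangentSpace I x →L[ℝ] TangentSpace I x

section Sections

variable [IsManifold I ∞ M]

/-- A vector field of class `C^∞`. -/
def IsSmoothVField (X : VField I M) : Prop :=
  ContMDiff I I.tangent ∞ (fun x ↦ TotalSpace.mk' E x (X x))

/-- The one-form `η`, as a map into the total space of the cotangent bundle. -/
def OneForm.toTotal (η : OneForm I M) (x : M) :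
    TotalSpace (E →L[ℝ] ℝ) (fun x : M ↦ TangentSpace I x →L[ℝ] Bundle.Trivial M ℝ x) :=
  ⟨x, η x⟩

/-- A one-form of class `C^∞`. -/
def IsSmoothOneForm (η : OneForm I M) : Prop :=
  ContMDiff I (I.prod 𝓘(ℝ, E →L[ℝ] ℝ)) ∞ η.toTotal

/-- The field `A`, as a map into the total space of the bundle `Hom(TM, TM)`. -/
def EndField.toTotal (A : EndField I M) (x : M) :
    TotalSpace (E →L[ℝ] E) (fun x : M ↦ TangentSpace I x →L[ℝ] TangentSpace I x) :=
  ⟨x, A x⟩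

/-- A field of endomorphisms of class `C^∞`. -/
def IsSmoothEndField (A : EndField I M) : Prop :=
  ContMDiff I (I.prod 𝓘(ℝ, E →L[ℝ] E)) ∞ A.toTotal

lemma mdifferentiableAt_oneForm_apply {η : OneForm I M} {X : VField I M} {x : M}
    (hη : MDifferentiableAt I (I.prod 𝓘(ℝ, E →L[ℝ] ℝ)) η.toTotal x)
    (hX : MDiffAt (T% X) x) : MDiffAt (fun y ↦ η y (X y)) x := by
  have : MDifferentiableAt I (I.prod 𝓘(ℝ)) (fun m ↦ TotalSpace.mk' ℝ
      (E := Bundle.Trivial M ℝ) m (η m (X m))) x :=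
    MDifferentiableAt.clm_bundle_apply (F₁ := E) (F₂ := ℝ) (b := fun m : M ↦ m) hη hX
  simp only [mdifferentiableAt_totalSpace] at this
  exact this.2

lemma mdifferentiableAt_endField_apply {A : EndField I M} {X : VField I M} {x : M}
    (hA : MDifferentiableAt I (I.prod 𝓘(ℝ, E →L[ℝ] E)) A.toTotal x)
    (hX : MDiffAt (T% X) x) : MDiffAt (T% (fun y ↦ A y (X y))) x :=
  MDifferentiableAt.clm_bundle_apply (F₁ := E) (F₂ := E) (b := fun m : M ↦ m) hA hX

end Sections

section LieAndExterior

variable [IsManifold I ∞ M] [FiniteDimensional ℝ E] [CompleteSpace E]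

open VectorField

/-- `X (η Y) - Y (η X) - η [X, Y]` at the point `x`. -/
def extDerivAux (η : OneForm I M) (x : M) (X Y : VField I M) : ℝ :=
  d% (fun y ↦ η y (Y y)) x (X x) - d% (fun y ↦ η y (X y)) x (Y x) - η x (mlieBracket I X Y x)

lemma extDerivAux_swap (η : OneForm I M) (x : M) (X Y : VField I M) :
    extDerivAux η x X Y = - extDerivAux η x Y X := by
  unfold extDerivAux
  rw [mlieBracket_swap_apply, map_neg]
  ring

lemma extDerivAux_tensorial {η : OneForm I M} {x : M}
    (hη : MDifferentiableAt I (I.prod 𝓘(ℝ, E →L[ℝ] ℝ)) η.toTotal x)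
    (X : VField I M) (_ : MDiffAt (T% X) x) :
    TensorialAt I E (fun Y ↦ extDerivAux η x X Y) x where
  smul {f Y} hf hY := by
    have h := mvfderiv_fun_mul hf (mdifferentiableAt_oneForm_apply hη hY)
    simp [extDerivAux, h, mlieBracket_smul_right hf hY]
    ring
  add {Y Y'} hY hY' := by
    have h := mvfderiv_fun_add (mdifferentiableAt_oneForm_apply hη hY)
      (mdifferentiableAt_oneForm_apply hη hY')
    simp [extDerivAux, h, mlieBracket_add_right hY hY']
    ring

lemma extDerivAux_tensorial' {η : OneForm I M} {x : M}
    (hη : MDifferentiableAt I (I.prod 𝓘(ℝ, E →L[ℝ] ℝ)) η.toTotal x)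
    (Y : VField I M) (hY : MDiffAt (T% Y) x) :
    TensorialAt I E (fun X ↦ extDerivAux η x X Y) x where
  smul hf hX := by
    simp only [extDerivAux_swap η x _ Y]
    rw [(extDerivAux_tensorial hη Y hY).smul hf hX, smul_neg]
  add hX hX' := by
    simp only [extDerivAux_swap η x _ Y]
    rw [(extDerivAux_tensorial hη Y hY).add hX hX', neg_add]

open scoped Classical in
/-- The exterior derivative `dη` of a one-form, normalised by
`dη(X, Y) = X (η Y) - Y (η X) - η [X, Y]` (the value is `0` where `η` is not differentiable). -/
def extDeriv (η : OneForm I M) (x : M) : TangentSpace I x →L[ℝ] TangentSpace I x →L[ℝ] ℝ :=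
  if hη : MDifferentiableAt I (I.prod 𝓘(ℝ, E →L[ℝ] ℝ)) η.toTotal x then
    TensorialAt.mkHom₂ (extDerivAux η x) x (extDerivAux_tensorial' hη) (extDerivAux_tensorial hη)
  else 0

theorem extDeriv_apply {η : OneForm I M} {x : M}
    (hη : MDifferentiableAt I (I.prod 𝓘(ℝ, E →L[ℝ] ℝ)) η.toTotal x) {X Y : VField I M}
    (hX : MDiffAt (T% X) x) (hY : MDiffAt (T% Y) x) :
    extDeriv η x (X x) (Y x) =
      d% (fun y ↦ η y (Y y)) x (X x) - d% (fun y ↦ η y (X y)) x (Y x)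
        - η x (mlieBracket I X Y x) := by
  rw [extDeriv, dif_pos hη]
  exact TensorialAt.mkHom₂_apply _ _ hX hY

/-- `[ξ, A X] - A [ξ, X]` at the point `x`. -/
def lieDerivAux (ξ : VField I M) (A : EndField I M) (x : M) (X : VField I M) : TangentSpace I x :=
  mlieBracket I ξ (fun y ↦ A y (X y)) x - A x (mlieBracket I ξ X x)

lemma lieDerivAux_tensorial (ξ : VField I M) {A : EndField I M} {x : M}
    (hA : MDifferentiableAt I (I.prod 𝓘(ℝ, E →L[ℝ] E)) A.toTotal x) :
    TensorialAt I E (lieDerivAux ξ A x) x where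
  smul {f X} hf hX := by
    have e : (fun y ↦ A y ((f • X) y)) = f • (fun y ↦ A y (X y)) := by
      ext y; simp
    simp only [lieDerivAux, e]
    rw [mlieBracket_smul_right hf hX,
      mlieBracket_smul_right hf (mdifferentiableAt_endField_apply hA hX)]
    simp only [map_add, map_smul]
    module
  add {X X'} hX hX' := by
    have e : (fun y ↦ A y ((X + X') y)) = (fun y ↦ A y (X y)) + (fun y ↦ A y (X' y)) := by
      ext y; simp
    simp only [lieDerivAux, e]
    rw [mlieBracket_add_right hX hX',
      mlieBracket_add_right (mdifferentiableAt_endField_apply hA hX)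
        (mdifferentiableAt_endField_apply hA hX')]
    simp only [map_add]
    module

open scoped Classical in
/-- The Lie derivative `L_ξ A` of a field of endomorphisms, `(L_ξ A) X = [ξ, A X] - A [ξ, X]`
(the value is `0` where `A` is not differentiable). -/
def lieDeriv (ξ : VField I M) (A : EndField I M) : EndField I M := fun x ↦
  if hA : MDifferentiableAt I (I.prod 𝓘(ℝ, E →L[ℝ] E)) A.toTotal x then
    TensorialAt.mkHom (lieDerivAux ξ A x) x (lieDerivAux_tensorial ξ hA)
  else 0

theorem lieDeriv_apply (ξ : VField I M) {A : EndField I M} {x : M}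
    (hA : MDifferentiableAt I (I.prod 𝓘(ℝ, E →L[ℝ] E)) A.toTotal x) {X : VField I M}
    (hX : MDiffAt (T% X) x) :
    lieDeriv ξ A x (X x) = mlieBracket I ξ (fun y ↦ A y (X y)) x - A x (mlieBracket I ξ X x) := by
  rw [lieDeriv, dif_pos hA]
  exact TensorialAt.mkHom_apply _ hX

end LieAndExterior

section LeviCivita

variable [IsManifold I ∞ M] [FiniteDimensional ℝ E] [CompleteSpace E]

open VectorField

/-- Riemannian metrics of class `C^∞` on `M`. -/
abbrev RMetric (I : ModelWithCorners ℝ E H) (M : Type*) [TopologicalSpace M] [ChartedSpace H M]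
    [IsManifold I ∞ M] :=
  ContMDiffRiemannianMetric I ∞ E (fun x : M ↦ TangentSpace I x)

variable (g : RMetric I M)

lemma mdifferentiableAt_metric {X Y : VField I M} {x : M}
    (hX : MDiffAt (T% X) x) (hY : MDiffAt (T% Y) x) :
    MDiffAt (fun y ↦ g.inner y (X y) (Y y)) x := by
  have : MDifferentiableAt I (I.prod 𝓘(ℝ)) (fun m ↦ TotalSpace.mk' ℝ
      (E := Bundle.Trivial M ℝ) m (g.inner m (X m) (Y m))) x := by
    apply MDifferentiableAt.clm_bundle_apply₂ (F₁ := E) (F₂ := E)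
    · exact g.contMDiff.mdifferentiableAt (by simp)
    · exact hX
    · exact hY
  simp only [mdifferentiableAt_totalSpace] at this
  exact this.2

/-- The right-hand side of the Koszul formula for `g(∇_X Y, Z)` at the point `x`. -/
def koszul (x : M) (Y X Z : VField I M) : ℝ :=
  (d% (fun y ↦ g.inner y (Y y) (Z y)) x (X x) + d% (fun y ↦ g.inner y (X y) (Z y)) x (Y x)
    - d% (fun y ↦ g.inner y (X y) (Y y)) x (Z x)
    + g.inner x (mlieBracket I X Y x) (Z x) - g.inner x (mlieBracket I X Z x) (Y x)
    - g.inner x (mlieBracket I Y Z x) (X x)) / 2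

lemma koszul_smul_left {x : M} {f : M → ℝ} {X Y Z : VField I M} (hf : MDiffAt f x)
    (hX : MDiffAt (T% X) x) (hY : MDiffAt (T% Y) x) (hZ : MDiffAt (T% Z) x) :
    koszul g x Y (f • X) Z = f x * koszul g x Y X Z := by
  have h1 := mvfderiv_fun_mul hf (mdifferentiableAt_metric g hX hZ)
  have h2 := mvfderiv_fun_mul hf (mdifferentiableAt_metric g hX hY)
  simp [koszul, h1, h2, mlieBracket_smul_left hf hX, g.symm x (X x)]
  ring

lemma koszul_add_left {x : M} {X X' Y Z : VField I M} (hX : MDiffAt (T% X) x)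
    (hX' : MDiffAt (T% X') x) (hY : MDiffAt (T% Y) x) (hZ : MDiffAt (T% Z) x) :
    koszul g x Y (X + X') Z = koszul g x Y X Z + koszul g x Y X' Z := by
  have h1 := mvfderiv_fun_add (mdifferentiableAt_metric g hX hZ)
    (mdifferentiableAt_metric g hX' hZ)
  have h2 := mvfderiv_fun_add (mdifferentiableAt_metric g hX hY)
    (mdifferentiableAt_metric g hX' hY)
  simp [koszul, h1, h2, mlieBracket_add_left hX hX']
  ring

lemma koszul_smul_right {x : M} {f : M → ℝ} {X Y Z : VField I M} (hf : MDiffAt f x)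
    (hX : MDiffAt (T% X) x) (hY : MDiffAt (T% Y) x) (hZ : MDiffAt (T% Z) x) :
    koszul g x Y X (f • Z) = f x * koszul g x Y X Z := by
  have h1 := mvfderiv_fun_mul hf (mdifferentiableAt_metric g hY hZ)
  have h2 := mvfderiv_fun_mul hf (mdifferentiableAt_metric g hX hZ)
  simp [koszul, h1, h2, mlieBracket_smul_right hf hZ, g.symm x (Z x)]
  ring

lemma koszul_add_right {x : M} {X Y Z Z' : VField I M} (hX : MDiffAt (T% X) x)
    (hY : MDiffAt (T% Y) x) (hZ : MDiffAt (T% Z) x) (hZ' : MDiffAt (T% Z') x) :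
    koszul g x Y X (Z + Z') = koszul g x Y X Z + koszul g x Y X Z' := by
  have h1 := mvfderiv_fun_add (mdifferentiableAt_metric g hX hZ)
    (mdifferentiableAt_metric g hX hZ')
  have h2 := mvfderiv_fun_add (mdifferentiableAt_metric g hY hZ)
    (mdifferentiableAt_metric g hY hZ')
  simp [koszul, h1, h2, mlieBracket_add_right hZ hZ']
  ring

lemma koszul_leibniz {x : M} {f : M → ℝ} {X Y Z : VField I M} (hf : MDiffAt f x)
    (hX : MDiffAt (T% X) x) (hY : MDiffAt (T% Y) x) (hZ : MDiffAt (T% Z) x) :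
    koszul g x (f • Y) X Z = f x * koszul g x Y X Z + d% f x (X x) * g.inner x (Y x) (Z x) := by
  have h1 := mvfderiv_fun_mul hf (mdifferentiableAt_metric g hY hZ)
  have h2 := mvfderiv_fun_mul hf (mdifferentiableAt_metric g hX hY)
  simp [koszul, h1, h2, mlieBracket_smul_right hf hY, mlieBracket_smul_left hf hY,
    g.symm x (X x) (Y x)]
  ring

lemma koszul_add_middle {x : M} {X Y Y' Z : VField I M} (hX : MDiffAt (T% X) x)
    (hY : MDiffAt (T% Y) x) (hY' : MDiffAt (T% Y') x) (hZ : MDiffAt (T% Z) x) :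
    koszul g x (Y + Y') X Z = koszul g x Y X Z + koszul g x Y' X Z := by
  have h1 := mvfderiv_fun_add (mdifferentiableAt_metric g hY hZ)
    (mdifferentiableAt_metric g hY' hZ)
  have h2 := mvfderiv_fun_add (mdifferentiableAt_metric g hX hY)
    (mdifferentiableAt_metric g hX hY')
  simp [koszul, h1, h2, mlieBracket_add_right hY hY', mlieBracket_add_left hY hY']
  ring

/-- The bilinear form `(X, Z) ↦ g(∇_X Y, Z)` at `x` given by the Koszul formula. -/
def koszulForm {Y : VField I M} {x : M} (hY : MDiffAt (T% Y) x) :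
    TangentSpace I x →L[ℝ] TangentSpace I x →L[ℝ] ℝ :=
  TensorialAt.mkHom₂ (koszul g x Y) x
    (fun _ hZ ↦
      { smul := fun hf hX ↦ koszul_smul_left g hf hX hY hZ
        add := fun hX hX' ↦ koszul_add_left g hX hX' hY hZ })
    (fun _ hX ↦
      { smul := fun hf hZ ↦ koszul_smul_right g hf hX hY hZ
        add := fun hZ hZ' ↦ koszul_add_right g hX hY hZ hZ' })

lemma koszulForm_apply {X Y Z : VField I M} {x : M} (hX : MDiffAt (T% X) x)
    (hY : MDiffAt (T% Y) x) (hZ : MDiffAt (T% Z) x) :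
    koszulForm g hY (X x) (Z x) = koszul g x Y X Z :=
  TensorialAt.mkHom₂_apply _ _ hX hZ

lemma koszulForm_apply_extend {Y : VField I M} {x : M} (hY : MDiffAt (T% Y) x)
    (u w : TangentSpace I x) :
    koszulForm g hY u w = koszul g x Y (FiberBundle.extend E u) (FiberBundle.extend E w) :=
  rfl

lemma metric_injective (x : M) : Function.Injective (g.inner x) := by
  rw [injective_iff_map_eq_zero]
  intro v hv
  by_contra h
  have := g.pos x v h
  simp [hv] at this

/-- The isomorphism `v ↦ g(v, ·)` from the tangent space to the cotangent space. -/
def flat (x : M) : TangentSpace I x ≃L[ℝ] (TangentSpace I x →L[ℝ] ℝ) :=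
  have : FiniteDimensional ℝ (TangentSpace I x) := inferInstanceAs (FiniteDimensional ℝ E)
  have : T2Space (TangentSpace I x) := inferInstanceAs (T2Space E)
  (LinearEquiv.ofInjectiveOfFinrankEq (g.inner x : TangentSpace I x →ₗ[ℝ] _)
    (metric_injective g x)
    (((LinearMap.toContinuousLinearMap (𝕜 := ℝ) (E := TangentSpace I x) (F' := ℝ)).finrank_eq.symm.trans
      Subspace.dual_finrank_eq).symm)).toContinuousLinearEquiv

lemma flat_apply (x : M) (u v : TangentSpace I x) : flat g x u v = g.inner x u v := rfl

lemma metric_flat_symm (x : M) (α : TangentSpace I x →L[ℝ] ℝ) (w : TangentSpace I x) :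
    g.inner x ((flat g x).symm α) w = α w := by
  rw [← flat_apply, ContinuousLinearEquiv.apply_symm_apply]

lemma metric_ext {x : M} {u v : TangentSpace I x} (h : ∀ w, g.inner x u w = g.inner x v w) :
    u = v :=
  metric_injective g x (ContinuousLinearMap.ext h)

open scoped Classical in
/-- `∇ Y` at `x`, where `∇` is the Levi-Civita connection: `X ↦ ∇_X Y` is determined by the
Koszul formula (the value is `0` where `Y` is not differentiable). -/
def leviCivitaAux (Y : VField I M) : EndField I M := fun x ↦
  if hY : MDiffAt (T% Y) x then
    ((flat g x).symm : (TangentSpace I x →L[ℝ] ℝ) →L[ℝ] TangentSpace I x) ∘L koszulForm g hY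
  else 0

lemma metric_leviCivitaAux {Y : VField I M} {x : M} (hY : MDiffAt (T% Y) x)
    (u w : TangentSpace I x) :
    g.inner x (leviCivitaAux g Y x u) w = koszulForm g hY u w := by
  rw [leviCivitaAux, dif_pos hY]
  exact metric_flat_symm g x _ w

/-- The Levi-Civita connection of `g`; `leviCivita g Y x (X x)` is `∇_X Y` at `x`. -/
def leviCivita : CovariantDerivative I E (TangentSpace I : M → Type _) where
  toFun := leviCivitaAux g
  isCovariantDerivativeOnUniv :=
    { add := by
        intro Y Y' x hY hY' _
        ext u
        refine metric_ext g fun w ↦ ?_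
        have hu := FiberBundle.mdifferentiableAt_extend I E u
        have hw := FiberBundle.mdifferentiableAt_extend I E w
        have hs := mdifferentiableAt_add_section hY hY'
        simp only [add_apply, map_add]
        rw [metric_leviCivitaAux g hs, metric_leviCivitaAux g hY, metric_leviCivitaAux g hY']
        exact koszul_add_middle g hu hY hY' hw
      leibniz := by
        intro Y f x hY hf _
        ext u
        refine metric_ext g fun w ↦ ?_
        have hu := FiberBundle.mdifferentiableAt_extend I E u
        have hw := FiberBundle.mdifferentiableAt_extend I E w
        have hs : MDiffAt (T% (f • Y)) x := hf.smul_section hY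
        simp only [add_apply, smul_apply, map_add,
          map_smul, ContinuousLinearMap.smulRight_apply, smul_eq_mul]
        rw [metric_leviCivitaAux g hs, metric_leviCivitaAux g hY]
        have := koszul_leibniz g hf hu hY hw
        simpa [koszulForm_apply_extend] using this }

theorem metric_leviCivita {X Y Z : VField I M} {x : M} (hX : MDiffAt (T% X) x)
    (hY : MDiffAt (T% Y) x) (hZ : MDiffAt (T% Z) x) :
    g.inner x (leviCivita g Y x (X x)) (Z x) = koszul g x Y X Z :=
  (metric_leviCivitaAux g hY _ _).trans (koszulForm_apply g hX hY hZ)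

/-- The Levi-Civita connection is torsion-free. -/
theorem leviCivita_torsion_free {X Y : VField I M} {x : M} (hX : MDiffAt (T% X) x)
    (hY : MDiffAt (T% Y) x) :
    leviCivita g Y x (X x) - leviCivita g X x (Y x) = mlieBracket I X Y x := by
  refine metric_ext g fun w ↦ ?_
  have hw := FiberBundle.mdifferentiableAt_extend I E w
  have h1 := metric_leviCivita g hX hY hw
  have h2 := metric_leviCivita g hY hX hw
  simp only [FiberBundle.extend_apply_self] at h1 h2
  rw [map_sub, sub_apply, h1, h2]
  simp only [koszul, mlieBracket_swap_apply (V := Y) (W := X), g.symm _ (Y _) (X _), map_neg,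
    neg_apply, FiberBundle.extend_apply_self]
  ring

/-- The Levi-Civita connection is compatible with the metric. -/
theorem leviCivita_metric {X Y Z : VField I M} {x : M} (hX : MDiffAt (T% X) x)
    (hY : MDiffAt (T% Y) x) (hZ : MDiffAt (T% Z) x) :
    d% (fun y ↦ g.inner y (Y y) (Z y)) x (X x) =
      g.inner x (leviCivita g Y x (X x)) (Z x) + g.inner x (Y x) (leviCivita g Z x (X x)) := by
  rw [g.symm x (Y x), metric_leviCivita g hX hY hZ, metric_leviCivita g hX hZ hY]
  simp only [koszul, mlieBracket_swap_apply (V := Z) (W := Y), g.symm _ (Z _) (Y _), map_neg,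
    neg_apply]
  ring

/-- The curvature `R(X, Y) Z = ∇_X ∇_Y Z - ∇_Y ∇_X Z - ∇_[X, Y] Z` of the Levi-Civita connection. -/
def curvature (X Y Z : VField I M) : VField I M := fun x ↦
  leviCivita g (fun y ↦ leviCivita g Z y (Y y)) x (X x)
    - leviCivita g (fun y ↦ leviCivita g Z y (X y)) x (Y x)
    - leviCivita g Z x (mlieBracket I X Y x)

end LeviCivita

section ContactMetric

variable [IsManifold I ∞ M] [FiniteDimensional ℝ E] [CompleteSpace E]

/-- The value of `η ∧ (dη)^n` on `v 0, …, v (2n)`, up to a positive factor that depends only on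
`n` and on the normalisation of the wedge product. -/
def contactVolume (n : ℕ) (η : OneForm I M) (x : M)
    (v : Fin (2 * n + 1) → TangentSpace I x) : ℝ :=
  ∑ σ : Equiv.Perm (Fin (2 * n + 1)), (Equiv.Perm.sign σ : ℝ) *
    (η x (v (σ 0)) * ∏ i : Fin n,
      extDeriv η x (v (σ ⟨2 * i + 1, by omega⟩)) (v (σ ⟨2 * i + 2, by omega⟩)))

/-- `η` is a contact form on the `(2n+1)`-dimensional manifold `M`: it is smooth and
`η ∧ (dη)^n` vanishes nowhere. -/
structure IsContactForm (n : ℕ) (η : OneForm I M) : Prop where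
  finrank_eq : Module.finrank ℝ E = 2 * n + 1
  smooth : IsSmoothOneForm η
  volume_ne_zero : ∀ x, ∃ v, contactVolume n η x v ≠ 0

/-- `(M, η, ξ, φ, g)` is a contact metric structure. -/
structure IsContactMetric (n : ℕ) (η : OneForm I M) (ξ : VField I M) (φ : EndField I M)
    (g : RMetric I M) : Prop where
  contact : IsContactForm n η
  smooth_reeb : IsSmoothVField ξ
  smooth_phi : IsSmoothEndField φ
  unit : ∀ x, g.inner x (ξ x) (ξ x) = 1
  eta_reeb : ∀ x, η x (ξ x) = 1
  phi_sq : ∀ x (u : TangentSpace I x), φ x (φ x u) = -u + η x u • ξ x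
  phi_reeb : ∀ x, φ x (ξ x) = 0
  extDeriv_eq : ∀ x (u v : TangentSpace I x), extDeriv η x u v = 2 * g.inner x u (φ x v)

/-- The tensor field `h = ½ L_ξ φ`. -/
def hTensor (ξ : VField I M) (φ : EndField I M) : EndField I M := fun x ↦
  (1 / 2 : ℝ) • lieDeriv ξ φ x

/-- `(M, η, ξ, φ, g)` is a K-contact structure: a contact metric structure with `h = 0`. -/
structure IsKContact (n : ℕ) (η : OneForm I M) (ξ : VField I M) (φ : EndField I M)
    (g : RMetric I M) : Prop extends IsContactMetric n η ξ φ g where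
  h_eq_zero : ∀ x, hTensor ξ φ x = 0

/-- `(M, η, ξ, φ, g)` is a weakly `(κ, μ)`-space: a contact metric structure with
`R(X, ξ) ξ = κ (X - η(X) ξ) + μ h X`. The identity is required at every point `x` for every vector
field `X` that is smooth near `x`. -/
structure IsWeaklyKappaMu (n : ℕ) (η : OneForm I M) (ξ : VField I M) (φ : EndField I M)
    (g : RMetric I M) (κ μ : ℝ) : Prop extends IsContactMetric n η ξ φ g where
  curvature_eq : ∀ (x : M) (X : VField I M), CMDiffAt ∞ (T% X) x →
    curvature g X ξ ξ x = κ • (X x - η x (X x) • ξ x) + μ • hTensor ξ φ x (X x)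

/-- The Boeckx invariant of a (non-K-contact) weakly `(κ, μ)`-space. -/
def boeckxInvariant (κ μ : ℝ) : ℝ := (1 - μ / 2) / √(1 - κ)

end ContactMetric

end

end ContactGeometry

/-!
Write `h = ½ L_ξ φ`. Everything follows from first-order identities between the fields `φ`, `h`,
`L_ξ h` and the metric, once the curvature condition has been rewritten in terms of Lie derivatives
along the Reeb field.

*General contact metric structures.* The form `η` is the metric dual of `ξ`, and `L_ξ η = 0`, hence
`L_ξ dη = 0` (`mvfderiv_extDeriv_apply`). Differentiating `φ² = -Id + η ⊗ ξ` and
`dη(X, φ Y) = -2 g(X, Y) + 2 η(X) η(Y)` along `ξ` shows that `h` anticommutes with `φ` and is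
symmetric, and that `(L_ξ g)(X, Y) = -2 g(X, φ h Y)`. The Koszul formula then gives
`∇ξ = -φ - φ h`, and since `∇` is torsion-free and `∇_ξ ξ = 0`, the operator `A = ∇ξ` satisfies
`R(X, ξ) ξ = -A² X - (L_ξ A) X`, that is
`R(X, ξ) ξ = -φ² X + h² X + 2 h X + φ (L_ξ h) X` (`IsContactMetric.curvature_reeb`).

*Weakly `(κ, μ)`-spaces.* The curvature condition now determines `φ (L_ξ h)`. Inserting it into the
Lie derivative `(L_ξ h) φ + φ (L_ξ h) = -4 h²` of the relation `h φ + φ h = 0` separates the parts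
that commute and anticommute with `φ`, and yields
`h² = (κ - 1) φ²` and `L_ξ h = 2 (1 - κ) φ + (2 - μ) φ h`
(`IsWeaklyKappaMu.h_h`, `IsWeaklyKappaMu.lieDeriv_h`). As `h` is symmetric, `κ ≥ 1` forces `h = 0`.

*The K-contact structure.* Consequently `(L_ξ h) h = (1 - κ) (2 φ h + (2 - μ) φ)`. The field
`ψ = 2 φ h + (2 - μ) φ` satisfies `ψ² = D φ²` with `D = (2 - μ)² - 4 (1 - κ)`, and `L_ξ ψ = 0`. The
form `-½ dη(X, ψ Y)` is `g(X, (2 - μ) Y + 2 h Y)` on the contact distribution, where the eigenvalues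
of `h` are `±√(1 - κ)`; hence it is definite, with the sign of `2 - μ`, exactly because
`|2 - μ| > 2 √(1 - κ)`, which is the condition `|I_M| > 1`.

Smoothness of all these fields is checked by evaluating them on vector fields that are smooth at a
point (`contMDiffAt_hom_of_apply`).
-/

namespace ContactGeometry

open VectorField Filter
open scoped Topology

/-! ### Smoothness of sections of homomorphism bundles -/

section Smoothness

variable {E : Type*} [NormedAddCommGroup E] [NormedSpace ℝ E] [FiniteDimensional ℝ E]
  {H : Type*} [TopologicalSpace H] {I : ModelWithCorners ℝ E H}
  {M : Type*} [TopologicalSpace M] [ChartedSpace H M]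

/-- A map into `F →L[ℝ] G`, with `F` finite-dimensional, is smooth if all its evaluations are. -/
theorem contMDiffAt_clm_of_apply {F G : Type*} [NormedAddCommGroup F] [NormedSpace ℝ F]
    [FiniteDimensional ℝ F] [NormedAddCommGroup G] [NormedSpace ℝ G]
    {f : M → F →L[ℝ] G} {x : M}
    (h : ∀ v, CMDiffAt ∞ (fun y ↦ f y v) x) : CMDiffAt ∞ f x := by
  have hd : Module.finrank ℝ F = Module.finrank ℝ (Fin (Module.finrank ℝ F) → ℝ) :=
    (Module.finrank_fin_fun ℝ).symm
  let e₁ := ContinuousLinearEquiv.ofFinrankEq hd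
  let e₂ := (e₁.arrowCongr (1 : G ≃L[ℝ] G)).trans
    (ContinuousLinearEquiv.piRing (Fin (Module.finrank ℝ F)))
  have h2 : ContMDiffAt I 𝓘(ℝ, Fin (Module.finrank ℝ F) → G) ∞ (fun y ↦ e₂ (f y)) x := by
    rw [contMDiffAt_pi_space]
    exact fun i ↦ h _
  have h3 := (e₂.symm.contDiff (n := ∞)).contMDiff.contMDiffAt (x := e₂ (f x))
  refine (ContMDiffAt.comp x h3 h2).congr_of_eventuallyEq (Eventually.of_forall fun y ↦ ?_)
  simp

/-- A section `A` of `Hom(V, W)` is smooth at `x` as soon as `A s` is smooth at `x` for every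
section `s` of `V` that is smooth at `x`. -/
theorem contMDiffAt_hom_of_apply {F G : Type*} [NormedAddCommGroup F] [NormedSpace ℝ F]
    [FiniteDimensional ℝ F] [NormedAddCommGroup G] [NormedSpace ℝ G]
    {V W : M → Type*} [TopologicalSpace (TotalSpace F V)] [∀ x, AddCommGroup (V x)]
    [∀ x, Module ℝ (V x)] [∀ x, TopologicalSpace (V x)] [FiberBundle F V] [VectorBundle ℝ F V]
    [ContMDiffVectorBundle ∞ F V I]
    [TopologicalSpace (TotalSpace G W)] [∀ x, AddCommGroup (W x)]
    [∀ x, Module ℝ (W x)] [∀ x, TopologicalSpace (W x)] [FiberBundle G W] [VectorBundle ℝ G W]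
    [∀ x, IsTopologicalAddGroup (W x)] [∀ x, ContinuousSMul ℝ (W x)]
    {A : ∀ x, V x →L[ℝ] W x} {x : M}
    (h : ∀ s : ∀ x, V x, CMDiffAt ∞ (T% s) x → CMDiffAt ∞ (T% (fun y ↦ A y (s y))) x) :
    CMDiffAt ∞ (fun y ↦ TotalSpace.mk' (F →L[ℝ] G) (E := fun x ↦ V x →L[ℝ] W x) y (A y)) x := by
  rw [contMDiffAt_hom_bundle]
  refine ⟨contMDiffAt_id, contMDiffAt_clm_of_apply fun v ↦ ?_⟩
  set t := trivializationAt F V x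
  set t' := trivializationAt G W x
  have hx : x ∈ t.baseSet := FiberBundle.mem_baseSet_trivializationAt' x
  have hx' : x ∈ t'.baseSet := FiberBundle.mem_baseSet_trivializationAt' x
  -- test `h` on the section that is constantly `v` in the trivialization of `V` around `x`
  have h1 : CMDiffAt ∞ (T% (FiberBundle.extend F (t.symm x v))) x :=
    FiberBundle.contMDiffAt_extend I F _
  have h2 := h _ h1
  rw [contMDiffAt_section] at h2
  refine h2.congr_of_eventuallyEq ?_
  filter_upwards [t.open_baseSet.mem_nhds hx, t'.open_baseSet.mem_nhds hx'] with y hy hy'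
  rw [ContinuousLinearMap.inCoordinates_eq hy hy']
  have e : t ⟨x, t.symm x v⟩ = (x, v) := t.apply_mk_symm hx v
  change (t' ⟨y, A y ((t.continuousLinearEquivAt ℝ y hy).symm v)⟩).2 =
    (t' ⟨y, A y (t.symm y (t ⟨x, t.symm x v⟩).2)⟩).2
  rw [e]
  rfl

variable [IsManifold I ∞ M]

theorem isSmoothEndField_of_apply {A : EndField I M}
    (h : ∀ (x : M) (X : VField I M), CMDiffAt ∞ (T% X) x → CMDiffAt ∞ (T% (fun y ↦ A y (X y))) x) :
    IsSmoothEndField A :=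
  fun x ↦ contMDiffAt_hom_of_apply (h x)

theorem IsSmoothEndField.apply {A : EndField I M} (hA : IsSmoothEndField A) {X : VField I M} {x : M}
    (hX : CMDiffAt ∞ (T% X) x) : CMDiffAt ∞ (T% (fun y ↦ A y (X y))) x :=
  ContMDiffAt.clm_bundle_apply (F₁ := E) (F₂ := E) (b := fun m : M ↦ m) (hA x) hX

theorem IsSmoothOneForm.apply {η : OneForm I M} (hη : IsSmoothOneForm η) {X : VField I M} {x : M}
    (hX : CMDiffAt ∞ (T% X) x) : CMDiffAt ∞ (fun y ↦ η y (X y)) x := by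
  have : ContMDiffAt I (I.prod 𝓘(ℝ)) ∞ (fun m ↦ TotalSpace.mk' ℝ
      (E := Bundle.Trivial M ℝ) m (η m (X m))) x :=
    ContMDiffAt.clm_bundle_apply (F₁ := E) (F₂ := ℝ) (b := fun m : M ↦ m) (hη x) hX
  simp only [contMDiffAt_totalSpace] at this
  exact this.2

theorem contMDiffAt_metric (g : RMetric I M) {X Y : VField I M} {x : M}
    (hX : CMDiffAt ∞ (T% X) x) (hY : CMDiffAt ∞ (T% Y) x) :
    CMDiffAt ∞ (fun y ↦ g.inner y (X y) (Y y)) x := by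
  have : ContMDiffAt I (I.prod 𝓘(ℝ)) ∞ (fun m ↦ TotalSpace.mk' ℝ
      (E := Bundle.Trivial M ℝ) m (g.inner m (X m) (Y m))) x := by
    apply ContMDiffAt.clm_bundle_apply₂ (F₁ := E) (F₂ := E)
    · exact g.contMDiff x
    · exact hX
    · exact hY
  simp only [contMDiffAt_totalSpace] at this
  exact this.2

/-- A field of bilinear forms is smooth if its values on vector fields smooth at a point are. -/
theorem contMDiff_bilin_of_apply {B : ∀ x : M, TangentSpace I x →L[ℝ] TangentSpace I x →L[ℝ] ℝ}
    (h : ∀ (x : M) (X Y : VField I M), CMDiffAt ∞ (T% X) x → CMDiffAt ∞ (T% Y) x →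
      CMDiffAt ∞ (fun y ↦ B y (X y) (Y y)) x) :
    ContMDiff I (I.prod 𝓘(ℝ, E →L[ℝ] E →L[ℝ] ℝ)) ∞
      (fun b ↦ TotalSpace.mk' (E →L[ℝ] E →L[ℝ] ℝ)
        (E := fun x ↦ TangentSpace I x →L[ℝ] TangentSpace I x →L[ℝ] ℝ) b (B b)) := by
  intro x
  refine contMDiffAt_hom_of_apply (W := fun x ↦ TangentSpace I x →L[ℝ] Bundle.Trivial M ℝ x)
    fun X hX ↦ ?_
  refine contMDiffAt_hom_of_apply (W := Bundle.Trivial M ℝ) fun Y hY ↦ ?_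
  rw [contMDiffAt_totalSpace]
  exact ⟨contMDiffAt_id, h x X Y hX hY⟩

end Smoothness

/-! ### Lie brackets of smooth vector fields -/

section Lie

variable {E : Type*} [NormedAddCommGroup E] [NormedSpace ℝ E] [FiniteDimensional ℝ E]
  [CompleteSpace E]
  {H : Type*} [TopologicalSpace H] {I : ModelWithCorners ℝ E H}
  {M : Type*} [TopologicalSpace M] [ChartedSpace H M] [IsManifold I ∞ M]

theorem contMDiffAt_mlieBracket {X Y : VField I M} {x : M}
    (hX : CMDiffAt ∞ (T% X) x) (hY : CMDiffAt ∞ (T% Y) x) :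
    CMDiffAt ∞ (T% (mlieBracket I X Y)) x := by
  have : IsManifold I (minSmoothness ℝ 2) M := by
    rw [minSmoothness_of_isRCLikeNormedField]; infer_instance
  have : IsManifold I (((⊤ : ℕ∞) : WithTop ℕ∞) + 1) M := by
    have e : ((⊤ : ℕ∞) : WithTop ℕ∞) + 1 = ∞ := rfl
    rw [e]; infer_instance
  refine ContMDiffAt.mlieBracket_vectorField (n := ⊤) (m := ⊤) hX hY ?_
  rw [minSmoothness_of_isRCLikeNormedField]
  exact le_rfl

theorem mlieBracket_jacobi {X Y Z : VField I M} {x : M}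
    (hX : CMDiffAt ∞ (T% X) x) (hY : CMDiffAt ∞ (T% Y) x) (hZ : CMDiffAt ∞ (T% Z) x) :
    mlieBracket I X (mlieBracket I Y Z) x =
      mlieBracket I (mlieBracket I X Y) Z x + mlieBracket I Y (mlieBracket I X Z) x := by
  have : IsManifold I (minSmoothness ℝ 3) M := by
    rw [minSmoothness_of_isRCLikeNormedField]
    exact IsManifold.of_le (n := ∞) ENat.LEInfty.out
  have h2 : minSmoothness ℝ 2 ≤ ∞ := by
    rw [minSmoothness_of_isRCLikeNormedField]; exact ENat.LEInfty.out
  exact leibniz_identity_mlieBracket_apply (hX.of_le h2) (hY.of_le h2) (hZ.of_le h2)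

theorem eventually_mdifferentiableAt {X : VField I M} {x : M} (hX : CMDiffAt ∞ (T% X) x) :
    ∀ᶠ y in 𝓝 x, MDiffAt (T% X) y := by
  have h := hX.of_le (n := ∞) (m := 1) ENat.LEInfty.out
  filter_upwards [(contMDiffAt_iff_contMDiffAt_nhds (by simp)).1 h] with y hy
  exact hy.mdifferentiableAt (by simp)

/-- `eventually_mdifferentiableAt` for functions. -/
theorem eventually_mdifferentiableAt_fun {f : M → ℝ} {x : M} (hf : CMDiffAt ∞ f x) :
    ∀ᶠ y in 𝓝 x, MDiffAt f y := by
  have h := hf.of_le (n := ∞) (m := 1) ENat.LEInfty.out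
  filter_upwards [(contMDiffAt_iff_contMDiffAt_nhds (by simp)).1 h] with y hy
  exact hy.mdifferentiableAt (by simp)

theorem isSmoothEndField_lieDeriv {ξ : VField I M} (hξ : IsSmoothVField ξ) {A : EndField I M}
    (hA : IsSmoothEndField A) : IsSmoothEndField (lieDeriv ξ A) := by
  refine isSmoothEndField_of_apply fun x X hX ↦ ?_
  have h : CMDiffAt ∞ (T% (mlieBracket I ξ (fun y ↦ A y (X y)) -
      fun y ↦ A y (mlieBracket I ξ X y))) x :=
    (contMDiffAt_mlieBracket (hξ x) (hA.apply hX)).sub_section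
      (hA.apply (contMDiffAt_mlieBracket (hξ x) hX))
  refine h.congr_of_eventuallyEq ?_
  filter_upwards [eventually_mdifferentiableAt hX] with y hy
  rw [lieDeriv_apply ξ ((hA y).mdifferentiableAt (by simp)) hy]
  rfl

end Lie

/-! ### Vector fields acting on functions -/

section Functions

variable {E : Type*} [NormedAddCommGroup E] [NormedSpace ℝ E] [FiniteDimensional ℝ E]
  [CompleteSpace E]
  {H : Type*} [TopologicalSpace H] {I : ModelWithCorners ℝ E H}
  {M : Type*} [TopologicalSpace M] [ChartedSpace H M] [IsManifold I ∞ M]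

theorem contMDiffAt_mvfderiv_apply {f : M → ℝ} {X : VField I M} {x : M}
    (hf : CMDiffAt ∞ f x) (hX : CMDiffAt ∞ (T% X) x) :
    CMDiffAt ∞ (fun y ↦ d% f y (X y)) x := by
  have h1 := hf.mfderiv_const (m := ∞) le_rfl
  have h2 := ContMDiffAt.clm_apply_of_inCoordinates (b₁ := fun m : M ↦ m) (b₂ := f)
    (F₁ := E) (F₂ := ℝ) (E₁ := (TangentSpace I : M → Type _)) (E₂ := TangentSpace 𝓘(ℝ, ℝ))
    (ϕ := fun m ↦ mfderiv I 𝓘(ℝ, ℝ) f m) (v := X) h1 hX hf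
  rw [contMDiffAt_totalSpace] at h2
  have h3 := h2.2
  refine h3.congr_of_eventuallyEq (Eventually.of_forall fun y ↦ ?_)
  simp [mvfderiv]
  rfl

theorem mvfderiv_congr {f f' : M → ℝ} {x : M} (h : f =ᶠ[𝓝 x] f') : d% f x = d% f' x := by
  ext v
  change mfderiv I 𝓘(ℝ, ℝ) f x v = mfderiv I 𝓘(ℝ, ℝ) f' x v
  rw [h.mfderiv_eq]
  rfl

/-- The vector field `[X, Y]` acts on functions as the commutator of `X` and `Y`. This is deduced
from the Jacobi identity and the Leibniz rule for Lie brackets, without passing to charts. -/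
theorem mvfderiv_mlieBracket {f : M → ℝ} {X Y : VField I M} {x : M}
    (hf : CMDiffAt ∞ f x) (hX : CMDiffAt ∞ (T% X) x) (hY : CMDiffAt ∞ (T% Y) x) :
    d% f x (mlieBracket I X Y x) =
      d% (fun y ↦ d% f y (Y y)) x (X x) - d% (fun y ↦ d% f y (X y)) x (Y x) := by
  rcases subsingleton_or_nontrivial E with hE | hE
  · have h0 : ∀ v : TangentSpace I x, v = 0 := fun v ↦ Subsingleton.elim (α := E) _ _
    rw [h0 (mlieBracket I X Y x), h0 (X x), h0 (Y x)]
    simp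
  obtain ⟨w, hw⟩ := exists_ne (0 : E)
  -- Comparing the two sides of the Jacobi identity for `X`, `Y` and `f • W`, where `W x ≠ 0`,
  -- gives the claim times `W x`.
  let W : VField I M := FiberBundle.extend E (x := x) w
  have hW : CMDiffAt ∞ (T% W) x := FiberBundle.contMDiffAt_extend I E _
  have hWx : W x ≠ 0 := by
    rw [show W x = w from FiberBundle.extend_apply_self ..]
    exact hw
  have d1 {Z : VField I M} (hZ : CMDiffAt ∞ (T% Z) x) : MDiffAt (T% Z) x :=
    hZ.mdifferentiableAt (by simp)
  have f1 {f : M → ℝ} (hf : CMDiffAt ∞ f x) : MDiffAt f x := hf.mdifferentiableAt (by simp)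
  have e (Z : VField I M) : mlieBracket I Z (f • W) =ᶠ[𝓝 x]
      (fun y ↦ d% f y (Z y)) • W + f • mlieBracket I Z W := by
    filter_upwards [eventually_mdifferentiableAt hW, eventually_mdifferentiableAt_fun hf]
      with y h1 h2
    exact mlieBracket_smul_right h2 h1
  have hXf := contMDiffAt_mvfderiv_apply hf hX
  have hYf := contMDiffAt_mvfderiv_apply hf hY
  have hXW := contMDiffAt_mlieBracket hX hW
  have hYW := contMDiffAt_mlieBracket hY hW
  have J := mlieBracket_jacobi hX hY (hf.smul_section hW)
  have J' := mlieBracket_jacobi hX hY hW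
  rw [EventuallyEq.rfl.mlieBracket_vectorField_eq (e Y),
    EventuallyEq.rfl.mlieBracket_vectorField_eq (e X),
    mlieBracket_add_right (d1 (hYf.smul_section hW)) (d1 (hf.smul_section hYW)),
    mlieBracket_add_right (d1 (hXf.smul_section hW)) (d1 (hf.smul_section hXW)),
    mlieBracket_smul_right (f1 hYf) (d1 hW), mlieBracket_smul_right (f1 hXf) (d1 hW),
    mlieBracket_smul_right (f1 hf) (d1 hXW), mlieBracket_smul_right (f1 hf) (d1 hYW),
    mlieBracket_smul_right (f1 hf) (d1 hW), J'] at J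
  have K : (d% f x (mlieBracket I X Y x) - (d% (fun y ↦ d% f y (Y y)) x (X x)
      - d% (fun y ↦ d% f y (X y)) x (Y x))) • W x = 0 := by
    rw [← sub_eq_zero] at J
    rw [← neg_eq_zero, ← J]
    module
  exact sub_eq_zero.1 ((smul_eq_zero.1 K).resolve_right hWx)

end Functions

/-! ### Lie derivatives of endomorphism fields and one-forms -/

section LieCalculus

variable {E : Type*} [NormedAddCommGroup E] [NormedSpace ℝ E] [FiniteDimensional ℝ E]
  [CompleteSpace E]
  {H : Type*} [TopologicalSpace H] {I : ModelWithCorners ℝ E H}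
  {M : Type*} [TopologicalSpace M] [ChartedSpace H M] [IsManifold I ∞ M]

theorem exists_contMDiffAt_eq {x : M} (u : TangentSpace I x) :
    ∃ X : VField I M, CMDiffAt ∞ (T% X) x ∧ X x = u :=
  ⟨FiberBundle.extend E u, FiberBundle.contMDiffAt_extend I E _,
    FiberBundle.extend_apply_self ..⟩

theorem mdifferentiableAt_of_smooth {X : VField I M} {x : M} (hX : CMDiffAt ∞ (T% X) x) :
    MDiffAt (T% X) x :=
  hX.mdifferentiableAt (by simp)

theorem IsSmoothOneForm.mdifferentiableAt {η : OneForm I M} (hη : IsSmoothOneForm η) (x : M) :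
    MDifferentiableAt I (I.prod 𝓘(ℝ, E →L[ℝ] ℝ)) η.toTotal x :=
  (hη x).mdifferentiableAt (by simp)

theorem IsSmoothEndField.mdifferentiableAt {A : EndField I M} (hA : IsSmoothEndField A) (x : M) :
    MDifferentiableAt I (I.prod 𝓘(ℝ, E →L[ℝ] E)) A.toTotal x :=
  (hA x).mdifferentiableAt (by simp)

theorem IsSmoothEndField.comp {A B : EndField I M} (hA : IsSmoothEndField A)
    (hB : IsSmoothEndField B) : IsSmoothEndField (fun x ↦ A x ∘L B x) :=
  isSmoothEndField_of_apply fun _ _ hX ↦ hA.apply (hB.apply hX)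

theorem IsSmoothEndField.const_smul {A : EndField I M} (hA : IsSmoothEndField A) (c : ℝ) :
    IsSmoothEndField (fun x ↦ c • A x) :=
  isSmoothEndField_of_apply fun _ _ hX ↦ (hA.apply hX).const_smul_section (a := c)

theorem IsSmoothEndField.add {A B : EndField I M} (hA : IsSmoothEndField A)
    (hB : IsSmoothEndField B) : IsSmoothEndField (fun x ↦ A x + B x) :=
  isSmoothEndField_of_apply fun _ _ hX ↦ (hA.apply hX).add_section (hB.apply hX)

theorem IsSmoothEndField.mlieBracket_apply {ξ : VField I M} {A : EndField I M}
    (hA : IsSmoothEndField A) {X : VField I M} {x : M} (hX : MDiffAt (T% X) x) :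
    mlieBracket I ξ (fun y ↦ A y (X y)) x = lieDeriv ξ A x (X x) + A x (mlieBracket I ξ X x) := by
  rw [lieDeriv_apply ξ (hA.mdifferentiableAt x) hX, sub_add_cancel]

/-- The Leibniz rule for the Lie derivative of a product of fields of endomorphisms. -/
theorem lieDeriv_comp {ξ : VField I M} {A B : EndField I M} (hA : IsSmoothEndField A)
    (hB : IsSmoothEndField B) (x : M) :
    lieDeriv ξ (fun y ↦ A y ∘L B y) x = lieDeriv ξ A x ∘L B x + A x ∘L lieDeriv ξ B x := by
  ext u
  obtain ⟨X, hX, rfl⟩ := exists_contMDiffAt_eq u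
  have h1 := lieDeriv_apply ξ ((hA.comp hB).mdifferentiableAt x) (mdifferentiableAt_of_smooth hX)
  have h2 := hA.mlieBracket_apply (ξ := ξ) (mdifferentiableAt_of_smooth (hB.apply hX))
  have h3 := hB.mlieBracket_apply (ξ := ξ) (mdifferentiableAt_of_smooth hX)
  simp only [ContinuousLinearMap.comp_apply] at h1
  rw [h1, h2, h3]
  simp only [map_add, add_apply, ContinuousLinearMap.comp_apply]
  abel

theorem lieDeriv_const_smul {ξ : VField I M} {A : EndField I M} (hA : IsSmoothEndField A) (c : ℝ)
    (x : M) : lieDeriv ξ (fun y ↦ c • A y) x = c • lieDeriv ξ A x := by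
  ext u
  obtain ⟨X, hX, rfl⟩ := exists_contMDiffAt_eq u
  have hX' := mdifferentiableAt_of_smooth hX
  have h1 := lieDeriv_apply ξ ((hA.const_smul c).mdifferentiableAt x) hX'
  have h2 := mlieBracket_const_smul_right (V := ξ) (c := c)
    (mdifferentiableAt_of_smooth (hA.apply hX))
  have h3 := hA.mlieBracket_apply (ξ := ξ) hX'
  rw [h1]
  change mlieBracket I ξ (c • fun y ↦ A y (X y)) x - _ = _
  rw [h2, h3]
  simp

theorem lieDeriv_add {ξ : VField I M} {A B : EndField I M} (hA : IsSmoothEndField A)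
    (hB : IsSmoothEndField B) (x : M) :
    lieDeriv ξ (fun y ↦ A y + B y) x = lieDeriv ξ A x + lieDeriv ξ B x := by
  ext u
  obtain ⟨X, hX, rfl⟩ := exists_contMDiffAt_eq u
  have hX' := mdifferentiableAt_of_smooth hX
  have h1 := lieDeriv_apply ξ ((hA.add hB).mdifferentiableAt x) hX'
  have h2 := mlieBracket_add_right (V := ξ) (mdifferentiableAt_of_smooth (hA.apply hX))
    (mdifferentiableAt_of_smooth (hB.apply hX))
  have h3 := hA.mlieBracket_apply (ξ := ξ) hX'
  have h4 := hB.mlieBracket_apply (ξ := ξ) hX'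
  rw [h1]
  change mlieBracket I ξ ((fun y ↦ A y (X y)) + fun y ↦ B y (X y)) x - _ = _
  rw [h2, h3, h4]
  simp only [add_apply]
  abel

theorem extDeriv_swap {η : OneForm I M} (hη : IsSmoothOneForm η) (x : M)
    (u v : TangentSpace I x) : extDeriv η x u v = - extDeriv η x v u := by
  obtain ⟨X, hX, rfl⟩ := exists_contMDiffAt_eq u
  obtain ⟨Y, hY, rfl⟩ := exists_contMDiffAt_eq v
  have hX' := mdifferentiableAt_of_smooth hX
  have hY' := mdifferentiableAt_of_smooth hY
  rw [extDeriv_apply (hη.mdifferentiableAt x) hX' hY',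
    extDeriv_apply (hη.mdifferentiableAt x) hY' hX', mlieBracket_swap_apply, map_neg]
  ring

/-- If `L_ξ η = 0`, then `L_ξ (dη) = 0`: expand `dη` and use that Lie brackets act on functions as
commutators, together with the Jacobi identity. -/
theorem mvfderiv_extDeriv_apply {η : OneForm I M} (hη : IsSmoothOneForm η) {ξ : VField I M}
    (hξ : IsSmoothVField ξ)
    (hL : ∀ (x : M) (X : VField I M), MDiffAt (T% X) x →
      d% (fun y ↦ η y (X y)) x (ξ x) = η x (mlieBracket I ξ X x))
    {X Y : VField I M} {x : M} (hX : CMDiffAt ∞ (T% X) x) (hY : CMDiffAt ∞ (T% Y) x) :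
    d% (fun y ↦ extDeriv η y (X y) (Y y)) x (ξ x) =
      extDeriv η x (mlieBracket I ξ X x) (Y x) + extDeriv η x (X x) (mlieBracket I ξ Y x) := by
  have e : (fun y ↦ extDeriv η y (X y) (Y y)) =ᶠ[𝓝 x] fun y ↦
      d% (fun z ↦ η z (Y z)) y (X y) - d% (fun z ↦ η z (X z)) y (Y y)
        - η y (mlieBracket I X Y y) := by
    filter_upwards [eventually_mdifferentiableAt hX, eventually_mdifferentiableAt hY] with y h1 h2
    exact extDeriv_apply (hη.mdifferentiableAt y) h1 h2
  have hbr := contMDiffAt_mlieBracket hX hY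
  have hξX := contMDiffAt_mlieBracket (hξ x) hX
  have hξY := contMDiffAt_mlieBracket (hξ x) hY
  have hηX := hη.apply hX
  have hηY := hη.apply hY
  have s1 : MDiffAt (fun y ↦ d% (fun z ↦ η z (Y z)) y (X y)) x :=
    (contMDiffAt_mvfderiv_apply hηY hX).mdifferentiableAt (by simp)
  have s2 : MDiffAt (fun y ↦ d% (fun z ↦ η z (X z)) y (Y y)) x :=
    (contMDiffAt_mvfderiv_apply hηX hY).mdifferentiableAt (by simp)
  have s3 : MDiffAt (fun y ↦ η y (mlieBracket I X Y y)) x :=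
    (hη.apply hbr).mdifferentiableAt (by simp)
  have s12 : MDiffAt (fun y ↦ d% (fun z ↦ η z (Y z)) y (X y) -
      d% (fun z ↦ η z (X z)) y (Y y)) x := s1.sub s2
  have cX := mvfderiv_mlieBracket hηY (hξ x) hX
  have cY := mvfderiv_mlieBracket hηX (hξ x) hY
  have eX : (fun y ↦ d% (fun z ↦ η z (X z)) y (ξ y)) =ᶠ[𝓝 x]
      fun y ↦ η y (mlieBracket I ξ X y) := by
    filter_upwards [eventually_mdifferentiableAt hX] with y h1 using hL y X h1
  have eY : (fun y ↦ d% (fun z ↦ η z (Y z)) y (ξ y)) =ᶠ[𝓝 x]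
      fun y ↦ η y (mlieBracket I ξ Y y) := by
    filter_upwards [eventually_mdifferentiableAt hY] with y h1 using hL y Y h1
  rw [mvfderiv_congr eY] at cX
  rw [mvfderiv_congr eX] at cY
  rw [mvfderiv_congr e, mvfderiv_fun_sub s12 s3, mvfderiv_fun_sub s1 s2,
    extDeriv_apply (hη.mdifferentiableAt x) (mdifferentiableAt_of_smooth hξX)
      (mdifferentiableAt_of_smooth hY),
    extDeriv_apply (hη.mdifferentiableAt x) (mdifferentiableAt_of_smooth hX)
      (mdifferentiableAt_of_smooth hξY)]
  simp only [sub_apply]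
  rw [hL x _ (mdifferentiableAt_of_smooth hbr), mlieBracket_jacobi (hξ x) hX hY, map_add, cX, cY]
  ring

end LieCalculus

/-! ### Identities of contact metric structures -/

section ContactMetricIdentities

variable {E : Type*} [NormedAddCommGroup E] [NormedSpace ℝ E] [FiniteDimensional ℝ E]
  [CompleteSpace E]
  {H : Type*} [TopologicalSpace H] {I : ModelWithCorners ℝ E H}
  {M : Type*} [TopologicalSpace M] [ChartedSpace H M] [IsManifold I ∞ M]
  {n : ℕ} {η : OneForm I M} {ξ : VField I M} {φ : EndField I M} {g : RMetric I M}

namespace IsContactMetric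

theorem metric_phi_swap (hc : IsContactMetric n η ξ φ g) (x : M) (u v : TangentSpace I x) :
    g.inner x u (φ x v) = - g.inner x v (φ x u) := by
  have h := extDeriv_swap hc.contact.smooth x u v
  rw [hc.extDeriv_eq, hc.extDeriv_eq] at h
  linarith

theorem metric_phi_left (hc : IsContactMetric n η ξ φ g) (x : M) (u v : TangentSpace I x) :
    g.inner x (φ x u) v = - g.inner x u (φ x v) := by
  rw [g.symm, hc.metric_phi_swap]

/-- `η` is the metric dual of `ξ`: both `g(φ u, φ v)` and `g(u, v)` are symmetric in `u` and `v`,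
hence so is their difference `η(u) g(ξ, v)`. -/
theorem metric_reeb (hc : IsContactMetric n η ξ φ g) (x : M) (u : TangentSpace I x) :
    g.inner x (ξ x) u = η x u := by
  have h1 := hc.metric_phi_left x u (φ x (ξ x))
  have h2 := hc.metric_phi_left x (ξ x) (φ x u)
  simp only [hc.phi_sq, hc.phi_reeb, map_zero, map_add, map_neg, map_smul, smul_eq_mul,
    zero_apply, hc.unit, neg_zero] at h1 h2
  linarith

theorem eta_phi (hc : IsContactMetric n η ξ φ g) (x : M) (u : TangentSpace I x) :
    η x (φ x u) = 0 := by
  rw [← hc.metric_reeb, hc.metric_phi_swap, hc.phi_reeb]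
  simp

theorem phi_phi_phi (hc : IsContactMetric n η ξ φ g) (x : M) (u : TangentSpace I x) :
    φ x (φ x (φ x u)) = - φ x u := by
  rw [hc.phi_sq, hc.eta_phi, zero_smul, add_zero]

theorem metric_phi_phi (hc : IsContactMetric n η ξ φ g) (x : M) (u v : TangentSpace I x) :
    g.inner x u (φ x (φ x v)) = - g.inner x u v + η x u * η x v := by
  rw [hc.phi_sq, map_add, map_neg, map_smul, smul_eq_mul, g.symm x u (ξ x), hc.metric_reeb]
  ring

/-- `L_ξ η = 0`. -/
theorem mvfderiv_eta (hc : IsContactMetric n η ξ φ g) (x : M) (X : VField I M)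
    (hX : MDiffAt (T% X) x) :
    d% (fun y ↦ η y (X y)) x (ξ x) = η x (mlieBracket I ξ X x) := by
  have h := extDeriv_apply (hc.contact.smooth.mdifferentiableAt x)
    (mdifferentiableAt_of_smooth (hc.smooth_reeb x)) hX
  have h1 : (fun y ↦ η y (ξ y)) = fun _ ↦ (1 : ℝ) := funext hc.eta_reeb
  rw [hc.extDeriv_eq, hc.metric_phi_swap, hc.phi_reeb, h1, mvfderiv_const] at h
  simp only [map_zero, neg_zero, mul_zero, zero_apply, sub_zero] at h
  linarith

theorem smooth_h (hc : IsContactMetric n η ξ φ g) : IsSmoothEndField (hTensor ξ φ) :=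
  (isSmoothEndField_lieDeriv hc.smooth_reeb hc.smooth_phi).const_smul _

theorem lieDeriv_phi (x : M) : lieDeriv ξ φ x = (2 : ℝ) • hTensor ξ φ x := by
  rw [hTensor, smul_smul]
  norm_num

theorem lieDeriv_phi_apply (x : M) (u : TangentSpace I x) :
    lieDeriv ξ φ x u = (2 : ℝ) • hTensor ξ φ x u := by
  rw [lieDeriv_phi]; rfl

/-- If `A ξ = 0`, then `(L_ξ A) ξ = 0`. -/
theorem lieDeriv_reeb (hc : IsContactMetric n η ξ φ g) {A : EndField I M} (hA : IsSmoothEndField A)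
    (h0 : ∀ x, A x (ξ x) = 0) (x : M) : lieDeriv ξ A x (ξ x) = 0 := by
  rw [lieDeriv_apply ξ (hA.mdifferentiableAt x) (mdifferentiableAt_of_smooth (hc.smooth_reeb x))]
  have h1 : (fun y ↦ A y (ξ y)) = 0 := funext h0
  simp [h1]

/-- If `η ∘ A = 0`, then `η ∘ (L_ξ A) = 0`. -/
theorem eta_lieDeriv (hc : IsContactMetric n η ξ φ g) {A : EndField I M} (hA : IsSmoothEndField A)
    (h0 : ∀ x u, η x (A x u) = 0) (x : M) (u : TangentSpace I x) : η x (lieDeriv ξ A x u) = 0 := by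
  obtain ⟨X, hX, rfl⟩ := exists_contMDiffAt_eq u
  rw [lieDeriv_apply ξ (hA.mdifferentiableAt x) (mdifferentiableAt_of_smooth hX), map_sub, h0,
    ← hc.mvfderiv_eta x _ (mdifferentiableAt_of_smooth (hA.apply hX))]
  have h1 : (fun y ↦ η y (A y (X y))) = fun _ ↦ (0 : ℝ) := funext fun y ↦ h0 y _
  rw [h1, mvfderiv_const]
  simp

theorem h_reeb (hc : IsContactMetric n η ξ φ g) (x : M) : hTensor ξ φ x (ξ x) = 0 := by
  have := hc.lieDeriv_reeb hc.smooth_phi hc.phi_reeb x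
  simp [hTensor, this]

theorem eta_h (hc : IsContactMetric n η ξ φ g) (x : M) (u : TangentSpace I x) :
    η x (hTensor ξ φ x u) = 0 := by
  have := hc.eta_lieDeriv hc.smooth_phi hc.eta_phi x u
  simp [hTensor, this]

/-- `h` and `φ` anticommute, since `L_ξ (φ²) = L_ξ (-Id + η ⊗ ξ) = 0`. -/
theorem h_phi (hc : IsContactMetric n η ξ φ g) (x : M) (u : TangentSpace I x) :
    hTensor ξ φ x (φ x u) = - φ x (hTensor ξ φ x u) := by
  obtain ⟨X, hX, rfl⟩ := exists_contMDiffAt_eq u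
  have hX' := mdifferentiableAt_of_smooth hX
  have hηX : MDiffAt (fun y ↦ η y (X y)) x :=
    (hc.contact.smooth.apply hX).mdifferentiableAt (by simp)
  have hξ := mdifferentiableAt_of_smooth (hc.smooth_reeb x)
  have h1 := lieDeriv_comp (ξ := ξ) hc.smooth_phi hc.smooth_phi x
  have h2 := congrArg (fun A ↦ A (X x)) h1
  simp only [lieDeriv_phi (φ := φ)] at h2
  rw [lieDeriv_apply ξ ((hc.smooth_phi.comp hc.smooth_phi).mdifferentiableAt x) hX'] at h2
  have e : (fun y ↦ (φ y ∘L φ y) (X y)) = (-1 : ℝ) • X + (fun y ↦ η y (X y)) • ξ := by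
    funext y
    simp [hc.phi_sq]
  rw [e, mlieBracket_add_right
      (mdifferentiableAt_of_smooth (hX.const_smul_section (a := (-1 : ℝ)))) (hηX.smul_section hξ),
    mlieBracket_const_smul_right hX', mlieBracket_smul_right hηX hξ, hc.mvfderiv_eta x X hX'] at h2
  simp only [mlieBracket_self, Pi.zero_apply, smul_zero, add_zero, neg_smul, one_smul,
    ContinuousLinearMap.comp_apply, hc.phi_sq, add_apply, smul_apply, map_smul] at h2
  rw [sub_self, ← smul_add] at h2
  exact eq_neg_of_add_eq_zero_left ((smul_eq_zero.1 h2.symm).resolve_left two_ne_zero)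

/-- `(L_ξ g)(X, Y) = -2 g(X, φ h Y)`: take the Lie derivative along `ξ` of
`dη(X, φ Y) = -2 g(X, Y) + 2 η(X) η(Y)`. -/
theorem lieDeriv_metric (hc : IsContactMetric n η ξ φ g) {X Y : VField I M} {x : M}
    (hX : CMDiffAt ∞ (T% X) x) (hY : CMDiffAt ∞ (T% Y) x) :
    d% (fun y ↦ g.inner y (X y) (Y y)) x (ξ x) - g.inner x (mlieBracket I ξ X x) (Y x)
      - g.inner x (X x) (mlieBracket I ξ Y x) =
      - 2 * g.inner x (X x) (φ x (hTensor ξ φ x (Y x))) := by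
  have hX' := mdifferentiableAt_of_smooth hX
  have hY' := mdifferentiableAt_of_smooth hY
  have h1 := mvfderiv_extDeriv_apply hc.contact.smooth hc.smooth_reeb hc.mvfderiv_eta hX
    (hc.smooth_phi.apply hY)
  rw [hc.smooth_phi.mlieBracket_apply hY', lieDeriv_phi_apply, map_add, map_smul] at h1
  have sX : MDiffAt (fun y ↦ η y (X y)) x :=
    (hc.contact.smooth.apply hX).mdifferentiableAt (by simp)
  have sY : MDiffAt (fun y ↦ η y (Y y)) x :=
    (hc.contact.smooth.apply hY).mdifferentiableAt (by simp)
  have sg : MDiffAt (fun y ↦ g.inner y (X y) (Y y)) x := mdifferentiableAt_metric g hX' hY'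
  have s1 : MDiffAt (fun y ↦ (-2 : ℝ) * g.inner y (X y) (Y y)) x :=
    MDifferentiableAt.mul mdifferentiableAt_const sg
  have s2 : MDiffAt (fun y ↦ η y (X y) * η y (Y y)) x := sX.mul sY
  have s3 : MDiffAt (fun y ↦ (2 : ℝ) * (η y (X y) * η y (Y y))) x :=
    MDifferentiableAt.mul mdifferentiableAt_const s2
  have e : (fun y ↦ extDeriv η y (X y) (φ y (Y y))) =
      fun y ↦ (-2 : ℝ) * g.inner y (X y) (Y y) + 2 * (η y (X y) * η y (Y y)) := by
    funext y
    rw [hc.extDeriv_eq, hc.metric_phi_phi]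
    ring
  rw [e, mvfderiv_fun_add s1 s3, mvfderiv_fun_mul mdifferentiableAt_const sg,
    mvfderiv_fun_mul mdifferentiableAt_const s2, mvfderiv_fun_mul sX sY] at h1
  simp only [add_apply, smul_apply, mvfderiv_const, smul_eq_mul,
    hc.mvfderiv_eta x X hX', hc.mvfderiv_eta x Y hY', hc.extDeriv_eq, hc.metric_phi_phi,
    smul_zero, add_zero] at h1
  linarith

/-- `φ h` is symmetric, because `L_ξ g` is. -/
theorem metric_phi_h_swap (hc : IsContactMetric n η ξ φ g) (x : M) (u v : TangentSpace I x) :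
    g.inner x u (φ x (hTensor ξ φ x v)) = g.inner x v (φ x (hTensor ξ φ x u)) := by
  obtain ⟨X, hX, rfl⟩ := exists_contMDiffAt_eq u
  obtain ⟨Y, hY, rfl⟩ := exists_contMDiffAt_eq v
  have h1 := hc.lieDeriv_metric hX hY
  have h2 := hc.lieDeriv_metric hY hX
  have e : (fun y ↦ g.inner y (X y) (Y y)) = fun y ↦ g.inner y (Y y) (X y) :=
    funext fun y ↦ g.symm y _ _
  rw [e, g.symm x _ (Y x), g.symm x (X x) (mlieBracket I ξ Y x)] at h1
  linarith

/-- `h` is symmetric. -/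
theorem metric_h_swap (hc : IsContactMetric n η ξ φ g) (x : M) (u v : TangentSpace I x) :
    g.inner x u (hTensor ξ φ x v) = g.inner x v (hTensor ξ φ x u) := by
  have h1 := hc.metric_phi_h_swap x u (φ x v)
  rw [hc.h_phi, map_neg, map_neg, hc.metric_phi_phi, hc.eta_h, hc.metric_phi_left,
    hc.metric_phi_phi, hc.eta_h] at h1
  linarith

/-- `∇_X ξ = -φ X - φ h X`: by the Koszul formula, `2 g(∇_X ξ, Z) = (L_ξ g)(X, Z) + dη(X, Z)`. -/
theorem leviCivita_reeb (hc : IsContactMetric n η ξ φ g) (x : M) (u : TangentSpace I x) :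
    leviCivita g ξ x u = - φ x u - φ x (hTensor ξ φ x u) := by
  refine metric_ext g fun w ↦ ?_
  obtain ⟨X, hX, rfl⟩ := exists_contMDiffAt_eq u
  obtain ⟨Z, hZ, rfl⟩ := exists_contMDiffAt_eq w
  have hX' := mdifferentiableAt_of_smooth hX
  have hZ' := mdifferentiableAt_of_smooth hZ
  rw [metric_leviCivita g hX' (mdifferentiableAt_of_smooth (hc.smooth_reeb x)) hZ', koszul]
  have h1 := hc.lieDeriv_metric hX hZ
  have h2 := extDeriv_apply (hc.contact.smooth.mdifferentiableAt x) hX' hZ'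
  have e1 : (fun y ↦ g.inner y (ξ y) (Z y)) = fun y ↦ η y (Z y) :=
    funext fun y ↦ hc.metric_reeb y _
  have e2 : (fun y ↦ g.inner y (X y) (ξ y)) = fun y ↦ η y (X y) :=
    funext fun y ↦ (g.symm y _ _).trans (hc.metric_reeb y _)
  rw [hc.extDeriv_eq] at h2
  rw [e1, e2, mlieBracket_swap_apply (V := X) (W := ξ), map_neg, neg_apply,
    g.symm x _ (ξ x), hc.metric_reeb, g.symm x (mlieBracket I ξ Z x)]
  rw [map_sub, map_neg, sub_apply, neg_apply, hc.metric_phi_left, g.symm x (φ x _) (Z x),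
    hc.metric_phi_h_swap]
  linarith

/-- The Jacobi operator of the Reeb field of a contact metric structure:
`R(X, ξ) ξ = -φ² X + h² X + 2 h X + φ (L_ξ h) X`. With `A = ∇ξ`, torsion-freeness and `A ξ = 0`
turn the curvature into `-A² X - (L_ξ A) X`. -/
theorem curvature_reeb (hc : IsContactMetric n η ξ φ g) {X : VField I M} {x : M}
    (hX : CMDiffAt ∞ (T% X) x) :
    curvature g X ξ ξ x = - φ x (φ x (X x)) + hTensor ξ φ x (hTensor ξ φ x (X x))
      + (2 : ℝ) • hTensor ξ φ x (X x) + φ x (lieDeriv ξ (hTensor ξ φ) x (X x)) := by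
  have hX' := mdifferentiableAt_of_smooth hX
  have hξ' := mdifferentiableAt_of_smooth (hc.smooth_reeb x)
  -- `A = ∇ξ = -φ - φ h`
  let A : EndField I M := fun y ↦ (-1 : ℝ) • (φ y + φ y ∘L hTensor ξ φ y)
  have hφh := hc.smooth_phi.comp hc.smooth_h
  have hA : IsSmoothEndField A := (hc.smooth_phi.add hφh).const_smul _
  have hnabla (y : M) (u : TangentSpace I y) : leviCivita g ξ y u = A y u := by
    rw [hc.leviCivita_reeb]
    simp [A]
    abel
  have hLA : lieDeriv ξ A x = (-1 : ℝ) • ((2 : ℝ) • hTensor ξ φ x +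
      (((2 : ℝ) • hTensor ξ φ x) ∘L hTensor ξ φ x + φ x ∘L lieDeriv ξ (hTensor ξ φ) x)) := by
    rw [lieDeriv_const_smul (hc.smooth_phi.add hφh), lieDeriv_add hc.smooth_phi hφh,
      lieDeriv_comp hc.smooth_phi hc.smooth_h, lieDeriv_phi]
  have e1 : (fun y ↦ leviCivita g ξ y (ξ y)) = 0 := by
    funext y
    simp [hnabla, A, hc.phi_reeb, hc.h_reeb]
  have e2 : (fun y ↦ leviCivita g ξ y (X y)) = fun y ↦ A y (X y) := funext fun y ↦ hnabla y _
  have h1 := leviCivita_torsion_free g hξ' (mdifferentiableAt_of_smooth (hA.apply hX))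
  rw [hA.mlieBracket_apply hX', hLA, hnabla] at h1
  rw [curvature, e1, e2, sub_eq_iff_eq_add.1 h1, hnabla, mlieBracket_swap_apply, map_neg,
    CovariantDerivative.zero]
  simp only [A, Pi.zero_apply, zero_apply, add_apply, smul_apply, map_smul, map_add, hc.h_phi,
    ContinuousLinearMap.comp_apply, map_neg]
  have e3 := hc.phi_sq x (hTensor ξ φ x (hTensor ξ φ x (X x)))
  rw [hc.eta_h, zero_smul, add_zero] at e3
  rw [e3]
  module

end IsContactMetric

end ContactMetricIdentities

/-! ### The tensor `h` of a weakly `(κ, μ)`-space -/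

section WeaklyKappaMu

variable {E : Type*} [NormedAddCommGroup E] [NormedSpace ℝ E] [FiniteDimensional ℝ E]
  [CompleteSpace E]
  {H : Type*} [TopologicalSpace H] {I : ModelWithCorners ℝ E H}
  {M : Type*} [TopologicalSpace M] [ChartedSpace H M] [IsManifold I ∞ M]
  {n : ℕ} {η : OneForm I M} {ξ : VField I M} {φ : EndField I M} {g : RMetric I M} {κ μ : ℝ}

/-- The Lie derivative along `ξ` of the relation `h φ + φ h = 0`. -/
theorem IsContactMetric.lieDeriv_h_phi (hc : IsContactMetric n η ξ φ g) (x : M)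
    (u : TangentSpace I x) :
    lieDeriv ξ (hTensor ξ φ) x (φ x u) + φ x (lieDeriv ξ (hTensor ξ φ) x u) =
      (-4 : ℝ) • hTensor ξ φ x (hTensor ξ φ x u) := by
  have e : (fun y ↦ hTensor ξ φ y ∘L φ y) = fun y ↦ (-1 : ℝ) • (φ y ∘L hTensor ξ φ y) := by
    funext y
    ext u
    simp [hc.h_phi]
  have h1 := lieDeriv_comp (ξ := ξ) hc.smooth_h hc.smooth_phi x
  rw [e, lieDeriv_const_smul (hc.smooth_phi.comp hc.smooth_h),
    lieDeriv_comp hc.smooth_phi hc.smooth_h, IsContactMetric.lieDeriv_phi] at h1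
  have h2 := congrArg (fun A ↦ A u) h1
  simp only [add_apply, smul_apply, ContinuousLinearMap.comp_apply, map_smul] at h2
  rw [← sub_eq_zero] at h2 ⊢
  rw [← neg_eq_zero, ← h2]
  module

namespace IsWeaklyKappaMu

/-- The curvature condition, solved for `φ (L_ξ h)`. -/
theorem phi_lieDeriv_h (hw : IsWeaklyKappaMu n η ξ φ g κ μ) (x : M) (u : TangentSpace I x) :
    φ x (lieDeriv ξ (hTensor ξ φ) x u) = (1 - κ) • φ x (φ x u)
      - hTensor ξ φ x (hTensor ξ φ x u) + (μ - 2) • hTensor ξ φ x u := by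
  have hc := hw.toIsContactMetric
  obtain ⟨X, hX, rfl⟩ := exists_contMDiffAt_eq u
  have h1 := hc.curvature_reeb hX
  rw [hw.curvature_eq x X hX] at h1
  have e : X x - η x (X x) • ξ x = - φ x (φ x (X x)) := by
    rw [hc.phi_sq]; abel
  rw [e] at h1
  rw [← sub_eq_zero] at h1 ⊢
  rw [← neg_eq_zero, ← h1]
  module

/-- `h² = (κ - 1) φ²`: the part of the curvature condition that commutes with `φ`. -/
theorem h_h (hw : IsWeaklyKappaMu n η ξ φ g κ μ) (x : M) (u : TangentSpace I x) :
    hTensor ξ φ x (hTensor ξ φ x u) = (κ - 1) • φ x (φ x u) := by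
  have hc := hw.toIsContactMetric
  -- Apply `φ` to the equation `(L_ξ h) φ + φ (L_ξ h) = -4 h²` and insert the value of
  -- `φ (L_ξ h)`; all terms but `φ h²` and `φ` cancel.
  have h1 := congrArg (φ x) (hc.lieDeriv_h_phi x u)
  rw [map_add, hw.phi_lieDeriv_h, hw.phi_lieDeriv_h] at h1
  simp only [hc.h_phi, map_add, map_sub, map_smul, map_neg, hc.phi_phi_phi, neg_neg] at h1
  have h2 : φ x (hTensor ξ φ x (hTensor ξ φ x u)) = (1 - κ) • φ x u := by
    have h3 : (2 : ℝ) • (φ x (hTensor ξ φ x (hTensor ξ φ x u)) - (1 - κ) • φ x u) = 0 := by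
      rw [← sub_eq_zero] at h1
      rw [← h1]
      module
    exact sub_eq_zero.1 ((smul_eq_zero.1 h3).resolve_left two_ne_zero)
  have h4 := congrArg (φ x) h2
  rw [hc.phi_sq, hc.eta_h, zero_smul, add_zero, map_smul] at h4
  rw [neg_eq_iff_eq_neg.1 h4]
  module

theorem lieDeriv_h (hw : IsWeaklyKappaMu n η ξ φ g κ μ) (x : M) (u : TangentSpace I x) :
    lieDeriv ξ (hTensor ξ φ) x u =
      (2 * (1 - κ)) • φ x u + (2 - μ) • φ x (hTensor ξ φ x u) := by
  have hc := hw.toIsContactMetric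
  have h1 := congrArg (φ x) (hw.phi_lieDeriv_h x u)
  rw [hc.phi_sq, hc.eta_lieDeriv hc.smooth_h hc.eta_h, hw.h_h] at h1
  simp only [map_add, map_sub, map_smul, hc.phi_phi_phi] at h1
  rw [zero_smul, add_zero, neg_eq_iff_eq_neg] at h1
  rw [h1]
  module

end IsWeaklyKappaMu
end WeaklyKappaMu

/-! ### The associated K-contact structure -/

section KContact

variable {E : Type*} [NormedAddCommGroup E] [NormedSpace ℝ E] [FiniteDimensional ℝ E]
  [CompleteSpace E]
  {H : Type*} [TopologicalSpace H] {I : ModelWithCorners ℝ E H}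
  {M : Type*} [TopologicalSpace M] [ChartedSpace H M] [IsManifold I ∞ M]
  {n : ℕ} {η : OneForm I M} {ξ : VField I M} {φ : EndField I M} {g : RMetric I M} {κ μ : ℝ}

theorem metric_self_nonneg (g : RMetric I M) (x : M) (u : TangentSpace I x) :
    0 ≤ g.inner x u u := by
  by_cases hu : u = 0
  · simp [hu]
  · exact (g.pos x u hu).le

namespace IsWeaklyKappaMu

theorem metric_h_h (hw : IsWeaklyKappaMu n η ξ φ g κ μ) (x : M) (u : TangentSpace I x) :
    g.inner x (hTensor ξ φ x u) (hTensor ξ φ x u) =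
      (1 - κ) * (g.inner x u u - η x u ^ 2) := by
  have hc := hw.toIsContactMetric
  rw [hc.metric_h_swap, hw.h_h, map_smul, hc.metric_phi_phi, smul_eq_mul]
  ring

/-- `h` is symmetric with `h² = (κ - 1) φ²`, so `h = 0` unless `κ < 1`. -/
theorem kappa_lt_one (hw : IsWeaklyKappaMu n η ξ φ g κ μ) (hK : ¬ IsKContact n η ξ φ g) :
    κ < 1 := by
  have hc := hw.toIsContactMetric
  by_contra hκ
  refine hK ⟨hc, fun x ↦ ?_⟩
  ext u
  by_contra hu
  have h1 := g.pos x _ hu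
  have h2 := metric_self_nonneg g x (φ x u)
  rw [hc.metric_phi_left, hc.metric_phi_phi] at h2
  rw [hw.metric_h_h] at h1
  nlinarith

/-- The operator `h` has norm at most `√(1 - κ)` on the contact distribution: `g(u, u) - η(u)²` is the
squared length of the component of `u` there. -/
theorem abs_metric_h_le (hw : IsWeaklyKappaMu n η ξ φ g κ μ) (hκ : κ < 1) (x : M)
    (u : TangentSpace I x) :
    |g.inner x u (hTensor ξ φ x u)| ≤ √(1 - κ) * (g.inner x u u - η x u ^ 2) := by
  have hc := hw.toIsContactMetric
  set s := √(1 - κ)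
  have hs : 0 < s := Real.sqrt_pos.2 (by linarith)
  have hs2 : s ^ 2 = 1 - κ := Real.sq_sqrt (by linarith)
  -- expand `0 ≤ g(h u + t φ² u, h u + t φ² u)`; `-φ² u` is the part of `u` in the contact
  -- distribution, and the choices `t = ±s` give the two bounds
  have key (t : ℝ) : 0 ≤ (1 - κ) * (g.inner x u u - η x u ^ 2)
      - 2 * t * g.inner x u (hTensor ξ φ x u) + t ^ 2 * (g.inner x u u - η x u ^ 2) := by
    have h1 := metric_self_nonneg g x (hTensor ξ φ x u + t • φ x (φ x u))
    simp only [map_add, map_smul, add_apply, smul_apply, smul_eq_mul, hw.metric_h_h,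
      hc.metric_phi_phi, hc.eta_phi, hc.eta_h, g.symm x (φ x (φ x u)),
      g.symm x (hTensor ξ φ x u) u] at h1
    linarith
  have h1 := key s
  have h2 := key (-s)
  rw [← hs2] at h1 h2
  rw [abs_le]
  constructor <;> nlinarith

theorem lieDeriv_h_h (hw : IsWeaklyKappaMu n η ξ φ g κ μ) (x : M) (u : TangentSpace I x) :
    lieDeriv ξ (hTensor ξ φ) x (hTensor ξ φ x u) =
      (1 - κ) • ((2 : ℝ) • φ x (hTensor ξ φ x u) + (2 - μ) • φ x u) := by
  have hc := hw.toIsContactMetric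
  rw [hw.lieDeriv_h, hw.h_h, map_smul, hc.phi_phi_phi]
  module

end IsWeaklyKappaMu

/-- The field of endomorphisms `r (2 φ h + c φ)`; for `c = 2 - μ` it is proportional to
`(L_ξ h) ∘ h`. -/
noncomputable def twistedPhi (ξ : VField I M) (φ : EndField I M) (r c : ℝ) : EndField I M :=
  fun x ↦ r • ((2 : ℝ) • (φ x ∘L hTensor ξ φ x) + c • φ x)

/-- The bilinear form `-½ d(u, ψ v) + α(u) α(v)` on a normed space. -/
noncomputable def associatedBilin {F : Type*} [NormedAddCommGroup F] [NormedSpace ℝ F]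
    (d : F →L[ℝ] F →L[ℝ] ℝ) (α : F →L[ℝ] ℝ) (ψ : F →L[ℝ] F) : F →L[ℝ] F →L[ℝ] ℝ :=
  (-(1 / 2) : ℝ) • (ContinuousLinearMap.precomp ℝ ψ ∘L d) + α.smulRight α

/-- The bilinear form `-½ dη(u, ψ v) + η(u) η(v)` on each tangent space. The tangent space is
identified with the model space `E`, as it carries no norm of its own. -/
noncomputable def associatedForm (η : OneForm I M) (ψ : EndField I M) (x : M) :
    TangentSpace I x →L[ℝ] TangentSpace I x →L[ℝ] ℝ :=
  associatedBilin (F := E) (extDeriv η x) (η x) (ψ x)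

theorem associatedForm_apply (η : OneForm I M) (ψ : EndField I M) (x : M)
    (u v : TangentSpace I x) :
    associatedForm η ψ x u v = -(1 / 2) * extDeriv η x u (ψ x v) + η x u * η x v :=
  rfl

namespace IsContactMetric

theorem smooth_twistedPhi (hc : IsContactMetric n η ξ φ g) (r c : ℝ) :
    IsSmoothEndField (twistedPhi ξ φ r c) :=
  (((hc.smooth_phi.comp hc.smooth_h).const_smul 2).add (hc.smooth_phi.const_smul c)).const_smul r

/-- The form associated with `r (2 φ h + c φ)`, expressed through `g` and `h`. -/
theorem associatedForm_twistedPhi (hc : IsContactMetric n η ξ φ g) (r c : ℝ) (x : M)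
    (u v : TangentSpace I x) :
    associatedForm η (twistedPhi ξ φ r c) x u v =
      r * (2 * g.inner x u (hTensor ξ φ x v) + c * (g.inner x u v - η x u * η x v))
        + η x u * η x v := by
  rw [associatedForm_apply, hc.extDeriv_eq]
  simp only [twistedPhi, add_apply, smul_apply, ContinuousLinearMap.comp_apply, map_smul, map_add,
    hc.metric_phi_phi, hc.eta_h, smul_eq_mul]
  ring

theorem contMDiff_associatedForm (hc : IsContactMetric n η ξ φ g) (r c : ℝ) :
    ContMDiff I (I.prod 𝓘(ℝ, E →L[ℝ] E →L[ℝ] ℝ)) ∞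
      (fun b ↦ TotalSpace.mk' (E →L[ℝ] E →L[ℝ] ℝ)
        (E := fun x ↦ TangentSpace I x →L[ℝ] TangentSpace I x →L[ℝ] ℝ) b
        (associatedForm η (twistedPhi ξ φ r c) b)) := by
  refine contMDiff_bilin_of_apply fun x X Y hX hY ↦ ?_
  simp only [hc.associatedForm_twistedPhi]
  have h1 := contMDiffAt_metric g hX (hc.smooth_h.apply hY)
  have h2 := contMDiffAt_metric g hX hY
  have h3 := (hc.contact.smooth.apply hX).mul (hc.contact.smooth.apply hY)
  exact (contMDiffAt_const.mul ((contMDiffAt_const.mul h1).add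
    (contMDiffAt_const.mul (h2.sub h3)))).add h3

end IsContactMetric

/-- A symmetric bilinear form that dominates a positive multiple of a Riemannian metric is
a Riemannian metric. -/
noncomputable def RMetric.ofDominating (g : RMetric I M)
    (B : ∀ x : M, TangentSpace I x →L[ℝ] TangentSpace I x →L[ℝ] ℝ)
    (symm : ∀ x u v, B x u v = B x v u) {δ : ℝ} (hδ : 0 < δ)
    (le : ∀ x u, δ * g.inner x u u ≤ B x u u)
    (smooth : ContMDiff I (I.prod 𝓘(ℝ, E →L[ℝ] E →L[ℝ] ℝ)) ∞
      (fun b ↦ TotalSpace.mk' (E →L[ℝ] E →L[ℝ] ℝ)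
        (E := fun x ↦ TangentSpace I x →L[ℝ] TangentSpace I x →L[ℝ] ℝ) b (B b))) :
    RMetric I M where
  inner := B
  symm := symm
  pos x u hu := (mul_pos hδ (g.pos x u hu)).trans_le (le x u)
  isVonNBounded x := by
    have h := (g.isVonNBounded x).image ((√δ)⁻¹ • ContinuousLinearMap.id ℝ (TangentSpace I x))
    refine h.subset ?_
    intro u (hu : B x u u < 1)
    refine (Set.mem_image _ _ _).2 ⟨√δ • u, ?_, ?_⟩
    · have h1 : √δ * (√δ * g.inner x u u) = δ * g.inner x u u := by
        rw [← mul_assoc, Real.mul_self_sqrt hδ.le]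
      simpa [h1] using (le x u).trans_lt hu
    · simp [smul_smul, (Real.sqrt_pos.2 hδ).ne']
  contMDiff := smooth

namespace IsWeaklyKappaMu

theorem twistedPhi_sq (hw : IsWeaklyKappaMu n η ξ φ g κ μ) (r : ℝ) (x : M)
    (u : TangentSpace I x) :
    twistedPhi ξ φ r (2 - μ) x (twistedPhi ξ φ r (2 - μ) x u) =
      (r ^ 2 * ((2 - μ) ^ 2 - 4 * (1 - κ))) • φ x (φ x u) := by
  have hc := hw.toIsContactMetric
  simp only [twistedPhi, add_apply, smul_apply, ContinuousLinearMap.comp_apply, map_smul, map_add,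
    hc.h_phi, map_neg, hw.h_h, hc.phi_phi_phi]
  module

/-- `L_ξ (2 φ h + (2 - μ) φ) = 0`. -/
theorem lieDeriv_twistedPhi (hw : IsWeaklyKappaMu n η ξ φ g κ μ) (r : ℝ) (x : M) :
    lieDeriv ξ (twistedPhi ξ φ r (2 - μ)) x = 0 := by
  have hc := hw.toIsContactMetric
  have hφh := hc.smooth_phi.comp hc.smooth_h
  unfold twistedPhi
  rw [lieDeriv_const_smul ((hφh.const_smul 2).add (hc.smooth_phi.const_smul _)),
    lieDeriv_add (hφh.const_smul 2) (hc.smooth_phi.const_smul _), lieDeriv_const_smul hφh,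
    lieDeriv_const_smul hc.smooth_phi, lieDeriv_comp hc.smooth_phi hc.smooth_h,
    IsContactMetric.lieDeriv_phi]
  ext u
  simp only [add_apply, smul_apply, ContinuousLinearMap.comp_apply, hw.phi_lieDeriv_h, hw.h_h,
    zero_apply]
  module

/-- A constant `r` with `r² D = 1`, where `D = (2 - μ)² - 4 (1 - κ)`, and with the sign of `2 - μ`
makes `r (2 φ h + (2 - μ) φ)` part of a K-contact structure. -/
theorem exists_isKContact (hw : IsWeaklyKappaMu n η ξ φ g κ μ) (hκ : κ < 1) {r : ℝ}
    (hr : r ^ 2 * ((2 - μ) ^ 2 - 4 * (1 - κ)) = 1)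
    (hpos : 0 < r * (2 - μ)) :
    ∃ g' : RMetric I M, IsKContact n η ξ (twistedPhi ξ φ r (2 - μ)) g' ∧
      ∀ x, g'.inner x = associatedForm η (twistedPhi ξ φ r (2 - μ)) x := by
  have hc := hw.toIsContactMetric
  set s := √(1 - κ) with hs_def
  have hs2 : s ^ 2 = 1 - κ := Real.sq_sqrt (by linarith)
  have hs : 0 < s := Real.sqrt_pos.2 (by linarith)
  -- lower bound, relative to `g`, for the new metric on the contact distribution
  set a := r * (2 - μ) - 2 * |r| * s
  have ha : 0 < a := by
    have : 2 * |r| * s < r * (2 - μ) := by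
      refine lt_of_pow_lt_pow_left₀ 2 hpos.le ?_
      rw [mul_pow, mul_pow, sq_abs, hs2]
      linarith
    exact sub_pos.2 this
  have hle (x : M) (u : TangentSpace I x) :
      min a 1 * g.inner x u u ≤ associatedForm η (twistedPhi ξ φ r (2 - μ)) x u u := by
    rw [hc.associatedForm_twistedPhi]
    have h1 := hw.abs_metric_h_le hκ x u
    rw [← hs_def] at h1
    have h2 := metric_self_nonneg g x (φ x u)
    rw [hc.metric_phi_left, hc.metric_phi_phi] at h2
    have h3 : -(|r| * |g.inner x u (hTensor ξ φ x u)|) ≤ r * g.inner x u (hTensor ξ φ x u) := by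
      rw [← abs_mul]; exact neg_abs_le _
    have h4 := mul_le_mul_of_nonneg_left h1 (abs_nonneg r)
    have h5 : min a 1 * (g.inner x u u - η x u ^ 2) ≤ a * (g.inner x u u - η x u ^ 2) :=
      mul_le_mul_of_nonneg_right (min_le_left _ _) (by linarith)
    have h6 : min a 1 * η x u ^ 2 ≤ 1 * η x u ^ 2 :=
      mul_le_mul_of_nonneg_right (min_le_right _ _) (sq_nonneg _)
    simp only [a] at h5 ⊢
    linarith
  let g' : RMetric I M := RMetric.ofDominating g (associatedForm η (twistedPhi ξ φ r (2 - μ)))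
    (fun x u v ↦ by
      rw [hc.associatedForm_twistedPhi, hc.associatedForm_twistedPhi, hc.metric_h_swap,
        g.symm x u v]
      ring) (lt_min ha one_pos) hle (hc.contMDiff_associatedForm _ _)
  have hg' (x : M) : g'.inner x = associatedForm η (twistedPhi ξ φ r (2 - μ)) x := rfl
  have hreeb (x : M) : twistedPhi ξ φ r (2 - μ) x (ξ x) = 0 := by
    simp [twistedPhi, hc.phi_reeb, hc.h_reeb]
  have hsq (x : M) (u : TangentSpace I x) : twistedPhi ξ φ r (2 - μ) x
      (twistedPhi ξ φ r (2 - μ) x u) = -u + η x u • ξ x := by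
    rw [hw.twistedPhi_sq, hr, one_smul, hc.phi_sq]
  refine ⟨g', ⟨⟨hc.contact, hc.smooth_reeb, hc.smooth_twistedPhi _ _, fun x ↦ ?_, hc.eta_reeb, hsq,
    hreeb, fun x u v ↦ ?_⟩, fun x ↦ ?_⟩, hg'⟩
  · simp [hg', associatedForm_apply, hreeb, hc.eta_reeb]
  · have h1 : η x (twistedPhi ξ φ r (2 - μ) x v) = 0 := by
      simp [twistedPhi, hc.eta_phi]
    have h2 : extDeriv η x u (ξ x) = 0 := by
      rw [hc.extDeriv_eq, hc.phi_reeb]; simp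
    rw [hg', associatedForm_apply, hsq, h1, map_add, map_neg, map_smul, h2]
    simp
  · rw [hTensor, hw.lieDeriv_twistedPhi, smul_zero]

end IsWeaklyKappaMu

theorem discriminant_pos_of_one_lt_abs_boeckxInvariant (hκ : κ < 1) (hI : 1 < |boeckxInvariant κ μ|) :
    0 < (2 - μ) ^ 2 - 4 * (1 - κ) := by
  have hs2 : √(1 - κ) ^ 2 = 1 - κ := Real.sq_sqrt (by linarith)
  have hs : 0 < √(1 - κ) := Real.sqrt_pos.2 (by linarith)
  rw [boeckxInvariant, abs_div, abs_of_pos hs, one_lt_div hs] at hI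
  have := pow_lt_pow_left₀ hI hs.le two_ne_zero
  rw [hs2, sq_abs] at this
  linarith

theorem boeckxInvariant_ne_zero (hI : 1 < |boeckxInvariant κ μ|) : boeckxInvariant κ μ ≠ 0 := by
  intro h
  rw [h, abs_zero] at hI
  linarith

theorem sign_boeckxInvariant_sq (hI : 1 < |boeckxInvariant κ μ|) :
    Real.sign (boeckxInvariant κ μ) ^ 2 = 1 := by
  rcases Real.sign_apply_eq_of_ne_zero _ (boeckxInvariant_ne_zero hI) with h | h <;>
    rw [h] <;> norm_num

theorem sign_boeckxInvariant_mul_pos (hκ : κ < 1) (hI : 1 < |boeckxInvariant κ μ|) :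
    0 < Real.sign (boeckxInvariant κ μ) * (2 - μ) := by
  have hs : 0 < √(1 - κ) := Real.sqrt_pos.2 (by linarith)
  have e : 2 - μ = 2 * √(1 - κ) * boeckxInvariant κ μ := by
    rw [boeckxInvariant]
    field_simp
  rw [e, mul_left_comm]
  exact mul_pos (by positivity) (Real.sign_mul_pos_of_ne_zero _ (boeckxInvariant_ne_zero hI))

end KContact

end ContactGeometry

theorem mainTheorem1 (n : ℕ) {M : Type*} [TopologicalSpace M]
    [ChartedSpace (EuclideanSpace ℝ (Fin (2 * n + 1))) M]
    [IsManifold 𝓘(ℝ, EuclideanSpace ℝ (Fin (2 * n + 1))) ∞ M]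
    (η : ContactGeometry.OneForm 𝓘(ℝ, EuclideanSpace ℝ (Fin (2 * n + 1))) M)
    (ξ : ContactGeometry.VField 𝓘(ℝ, EuclideanSpace ℝ (Fin (2 * n + 1))) M)
    (φ : ContactGeometry.EndField 𝓘(ℝ, EuclideanSpace ℝ (Fin (2 * n + 1))) M)
    (g : ContactGeometry.RMetric 𝓘(ℝ, EuclideanSpace ℝ (Fin (2 * n + 1))) M)
    (κ μ : ℝ)
    (hM : ContactGeometry.IsWeaklyKappaMu n η ξ φ g κ μ)
    (hK : ¬ ContactGeometry.IsKContact n η ξ φ g)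
    (hI : 1 < |ContactGeometry.boeckxInvariant κ μ|) :
    κ < 1 ∧ 0 < (2 - μ) ^ 2 - 4 * (1 - κ) ∧
    ∃ (φ' : ContactGeometry.EndField 𝓘(ℝ, EuclideanSpace ℝ (Fin (2 * n + 1))) M)
      (g' : ContactGeometry.RMetric 𝓘(ℝ, EuclideanSpace ℝ (Fin (2 * n + 1))) M),
      ContactGeometry.IsKContact n η ξ φ' g' ∧
      (∀ x, φ' x =
        (Real.sign (ContactGeometry.boeckxInvariant κ μ) /
            ((1 - κ) * √((2 - μ) ^ 2 - 4 * (1 - κ)))) •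
          (ContactGeometry.lieDeriv ξ (ContactGeometry.hTensor ξ φ) x ∘L
            ContactGeometry.hTensor ξ φ x)) ∧
      (∀ x u v, g'.inner x u v =
        -(1 / 2) * ContactGeometry.extDeriv η x u (φ' x v) + η x u * η x v) := by
  have hκ := hM.kappa_lt_one hK
  have hD := ContactGeometry.discriminant_pos_of_one_lt_abs_boeckxInvariant hκ hI
  have hsq := ContactGeometry.sign_boeckxInvariant_sq hI
  have hsign := ContactGeometry.sign_boeckxInvariant_mul_pos hκ hI
  refine ⟨hκ, hD, ?_⟩
  have hD' := Real.sqrt_pos.2 hD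
  obtain ⟨g', hKC, hg'⟩ := hM.exists_isKContact hκ
    (r := Real.sign (ContactGeometry.boeckxInvariant κ μ) / √((2 - μ) ^ 2 - 4 * (1 - κ)))
    (by rw [div_pow, Real.sq_sqrt hD.le, hsq, one_div, inv_mul_cancel₀ hD.ne'])
    (by rw [div_mul_eq_mul_div]; exact div_pos hsign hD')
  refine ⟨_, g', hKC, fun x ↦ ?_, fun x u v ↦ ?_⟩
  -- the factor `1 - κ` of `(L_ξ h) ∘ h` cancels
  · ext1 u
    have h1 : 1 - κ ≠ 0 := by linarith
    rw [smul_apply, ContinuousLinearMap.comp_apply, hM.lieDeriv_h_h, smul_smul]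
    rw [show Real.sign (ContactGeometry.boeckxInvariant κ μ) /
      ((1 - κ) * √((2 - μ) ^ 2 - 4 * (1 - κ))) * (1 - κ) =
      Real.sign (ContactGeometry.boeckxInvariant κ μ) / √((2 - μ) ^ 2 - 4 * (1 - κ)) by
        field_simp]
    simp [ContactGeometry.twistedPhi]
  · rw [hg', ContactGeometry.associatedForm_apply]
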